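/- Let $R$ be an associative ring with identity, let $n\ge 0$ be an integer, and let $T$ be a (not necessarily finitely generated) $n$-tilting right $R$-module of projective dimension exactly $n$. That is, $\operatorname{pd} T=n$ and: (T1) there is an exact sequence $0\to P_n\to\cdots\to P_0\to T\to 0$ in $\mathrm{Mod}\text{-}R$ with all $P_i$ projective; (T2) $\operatorname{Ext}^i_R(T,T^{(\alpha)})=0$ for all $i>0$ and all sets $\alpha$; (T3) there is an exact sequence $0\to R\to T_0\to\cdots\to T_n\to 0$ in $\mathrm{Mod}\text{-}R$ in which every $T_i$ is a direct summand of a direct sum of copies of $T$. Let $\mathcal D=(\mathcal D^{\le 0},\mathcal D^{\ge 0})$ be the natural $t$-structure on the derived category $D(R)$ of $\mathrm{Mod}\text{-}R$. Let $\operatorname{Susp}(T)$ be the smallest full subcategory of $D(R)$ that contains $T$ and is closed under extensions, positive shifts and set-indexed direct sums. Then $\operatorname{Susp}(T)$ is the aisle $\mathcal T^{\le 0}$ of a (necessarily unique) $t$-structure $\mathcal T=(\mathcal T^{\le 0},\mathcal T^{\ge 0})$ on $D(R)$, the $t$-structure generated by $T$, and the pair $(\mathcal D,\mathcal T)$ is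 (right) $n$-tilting, that is: 1. it is right filterable: for every $i\in\mathbb Z$ the intersection $\mathcal D^{\ge i}\cap\mathcal T^{\ge 0}$ is the co-aisle of a $t$-structure on $D(R)$; 2. it is of type $(n,0)$: $0$ is the greatest integer $k$ with $\mathcal T^{\le k}\subseteq\mathcal D^{\le 0}$, and $n$ is the least natural number $m$ with $\mathcal D^{\le -m}\subseteq\mathcal T^{\le 0}$; 3. $\mathcal H_{\mathcal D}\cap\mathcal H_{\mathcal T}$ cogenerates $\mathcal H_{\mathcal D}\simeq\mathrm{Mod}\text{-}R$, where $\mathcal H_{\mathcal D}=\mathcal D^{\le 0}\cap\mathcal D^{\ge 0}$ and $\mathcal H_{\mathcal T}=\mathcal T^{\le 0}\cap\mathcal T^{\ge 0}$ are the hearts: every object of $\mathcal H_{\mathcal D}$ admits a monomorphism in $\mathcal H_{\mathcal D}$ to an object of $\mathcal H_{\mathcal D}\cap\mathcal H_{\mathcal T}$. Moreover, every injective right $R$-module, viewed as a complex concentrated in degree $0$, belongs to $\mathcal H_{\mathcal T}$. -/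

import Mathlib

open CategoryTheory CategoryTheory.Limits CategoryTheory.Pretriangulated CategoryTheory.Triangulated

universe w v u

section TStructures

variable {C : Type u} [Category.{v} C] [Preadditive C] [HasZeroObject C] [HasShift C ℤ]
  [∀ n : ℤ, (shiftFunctor C n).Additive] [Pretriangulated C]

/-- The pair `(𝒟, 𝒯)` of t-structures has shift `k` and gap `n` (it is of type `(n, k)`):
`k` is the greatest integer with `𝒯^{≤ k} ⊆ 𝒟^{≤ 0}`, and `n` is the least natural number with
`𝒟^{≤ -n} ⊆ 𝒯^{≤ k}`. -/
structure HasTypeGapShift (𝒟 𝒯 : TStructure C) (n : ℕ) (k : ℤ) : Prop where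
  shift : IsGreatest {m : ℤ | 𝒯.le m ≤ 𝒟.le 0} k
  gap : IsLeast {m : ℕ | 𝒟.le (-(m : ℤ)) ≤ 𝒯.le k} n

/-- `P` is the co-aisle of some t-structure on `C`. -/
def IsCoaisle (P : ObjectProperty C) : Prop :=
  ∃ t : TStructure C, t.ge 0 = P

/-- The pair `(𝒟, 𝒯)` is right filterable: all the intersections `𝒟^{≥ i} ∩ 𝒯^{≥ 0}` are
co-aisles. -/
def IsRightFilterable (𝒟 𝒯 : TStructure C) : Prop :=
  ∀ i : ℤ, IsCoaisle (𝒟.ge i ⊓ 𝒯.ge 0)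

/-- A class `P` of objects of a category `A` cogenerates `A`: every object of `A` embeds in an
object of `P`. -/
def Cogenerates {A : Type*} [Category* A] (P : ObjectProperty A) : Prop :=
  ∀ X : A, ∃ (Y : A) (f : X ⟶ Y), P Y ∧ Mono f

/-- The pair `(𝒟, 𝒯)` is (right) `n`-tilting: it is right filterable, of type `(n, 0)`, and
`ℋ_𝒟 ∩ ℋ_𝒯`, as a class of objects of the category `ℋ_𝒟`, cogenerates `ℋ_𝒟`. -/
structure IsRightTiltingPair (𝒟 𝒯 : TStructure C) (n : ℕ) : Prop where
  rightFilterable : IsRightFilterable 𝒟 𝒯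
  type : HasTypeGapShift 𝒟 𝒯 n 0
  cogenerates :
    Cogenerates (A := 𝒟.heart.FullSubcategory) (fun X => 𝒯.heart X.obj)

/-- `P` is a suspended subcategory of `C` (closed under extensions and positive shifts) which is
moreover closed under all direct sums, indexed by sets in `Type w`, that exist in `C`. -/
structure IsSuspendedWithSums (P : ObjectProperty C) : Prop where
  ext : ∀ S : Triangle C, S ∈ distTriang C → P S.obj₁ → P S.obj₃ → P S.obj₂
  shift : ∀ (X : C) (j : ℤ), 0 < j → P X → P (X⟦j⟧)
  sum : ∀ (J : Type w) (F : J → C) (c : Cofan F), Nonempty (IsColimit c) →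
    (∀ j, P (F j)) → P c.pt

/-- `Susp(E)`: the smallest suspended subcategory of `C` which is closed under set-indexed direct
sums and contains `E`. -/
def Susp (E : C) : ObjectProperty C := fun X =>
  ∀ P : ObjectProperty C, IsSuspendedWithSums.{w} P → P E → P X

/-- `𝒯` is the t-structure generated by `E`: its aisle is `Susp(E)`. (A t-structure is determined
by its aisle.) -/
def IsGeneratedBy (𝒯 : TStructure C) (E : C) : Prop :=
  𝒯.le 0 = Susp.{w} E

end TStructures

section TiltingModules

variable {R : Type u} [Ring R]

/-- The direct sum `T^(α)` of copies of the right `R`-module `T` indexed by the set `α`. Here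
`Mod-R` is the category of left modules over the opposite ring `Rᵐᵒᵖ`. -/
noncomputable abbrev copies (T : ModuleCat.{u} Rᵐᵒᵖ) (α : Type u) : ModuleCat.{u} Rᵐᵒᵖ :=
  ModuleCat.of Rᵐᵒᵖ (α →₀ T)

/-- `M` is a direct summand of a direct sum of copies of `T`. -/
def IsSummandOfCopies (T M : ModuleCat.{u} Rᵐᵒᵖ) : Prop :=
  ∃ α : Type u, Nonempty (Retract M (copies T α))

/-- The right `R`-module `T` satisfies the axioms (T1), (T2), (T3) of an `n`-tilting module.
The finite exact sequences are written as sequences indexed by `ℕ` whose terms of index greater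
than `n` are zero. -/
structure IsTiltingModule (T : ModuleCat.{u} Rᵐᵒᵖ) (n : ℕ) : Prop where
  /-- An exact sequence `0 → P n → ⋯ → P 1 → P 0 → T → 0` with all `P i` projective. -/
  resolution : ∃ (P : ℕ → ModuleCat.{u} Rᵐᵒᵖ) (d : ∀ i, P (i + 1) ⟶ P i) (ε : P 0 ⟶ T),
    (∀ i ≤ n, Projective (P i)) ∧ (∀ i, n < i → IsZero (P i)) ∧
    Function.Surjective ε ∧ Function.Exact (d 0) ε ∧
    ∀ i, Function.Exact (d (i + 1)) (d i)
  /-- `Ext^i(T, T^(α)) = 0` for all `i > 0` and all sets `α`. -/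
  ext_copies : ∀ (i : ℕ) (α : Type u), 0 < i → Subsingleton (Abelian.Ext T (copies T α) i)
  /-- An exact sequence `0 → R → T₀ → T₁ → ⋯ → Tₙ → 0` with all `Tᵢ` direct summands of direct
  sums of copies of `T`. -/
  coresolution : ∃ (S : ℕ → ModuleCat.{u} Rᵐᵒᵖ) (d : ∀ i, S i ⟶ S (i + 1))
      (η : ModuleCat.of Rᵐᵒᵖ R ⟶ S 0),
    (∀ i ≤ n, IsSummandOfCopies T (S i)) ∧ (∀ i, n < i → IsZero (S i)) ∧
    Function.Injective η ∧ Function.Exact η (d 0) ∧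
    ∀ i, Function.Exact (d i) (d (i + 1))

end TiltingModules

-- The heart of the matter is that Susp(T) consists of the X with Hom(T, X[j]) = 0 for all j > 0
-- (`suspVanishing_eq_susp`, `susp_of_homVanishes`). The axioms enter as follows. By (T1), Hom(T,
-- X[j]) = 0 for X in D^{≤m} and j > m+n (`homVanishes_of_isLE`). By (T3), H^j(X) = 0 as soon as
-- Hom(T, X[i]) = 0 for j ≤ i ≤ j+n (`homVanishes_regular`), and R[n] lies in Susp(T); since R
-- generates D^{≤0} (`of_isLE`), D^{≤-n} ⊆ Susp(T). By (T2), coning off a universal map T^(α) → X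
-- kills Hom(T, X) and can create new morphisms only in degree -1 (`exists_kill`), so the degrees 0,
-- -1, -2, … can be killed in turn, with fibres in Susp(T).
--
-- After n kills, an object without positive Homs from T lands in D^{≤-n}, so it was in Susp(T).
-- After 2n kills, an arbitrary object has no cohomology in degrees -2n < j ≤ -n; dividing out its
-- truncation τ^{≤-n} leaves an object right orthogonal to all T[k], k ≥ 0 (`exists_approximation`).
-- Hence Susp(T) is an aisle, reached in finitely many steps.
--
-- Injectives satisfy the Hom criterion, which gives cogeneration. The gap is exactly n because
-- D^{≤-m} ⊆ Susp(T) forces Ext^i(T, -) = 0 for i > m. Filterability comes from a different source: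
-- D^{≥i} ∩ T^{≥0} is the right orthogonal of a set of shifts of R and T, and the small object
-- argument for complexes makes any such orthogonal a torsion-free class
-- (`exists_triangle_of_isKProjective`).

universe t

/-! ### Null-homotopies as lifts to path objects and extensions to cones. -/

section Homotopies

open CochainComplex CochainComplex.HomComplex

variable {A : Type u} [Category.{v} A] [Abelian A]

/-- Up to sign, `mappingCocone.snd` is the universal null-homotopy of the projection from the path
object. -/
lemma CochainComplex.mappingCocone.δ_snd_id (V : CochainComplex A ℤ) :
    δ (-1) 0 (mappingCocone.snd (𝟙 V)) = -Cochain.ofHom (mappingCocone.fst (𝟙 V)) := by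
  have h := mappingCocone.δ_descCochain (𝟙 V) (M := V) (m := -1) (n := 0)
    0 (Cochain.ofHom (𝟙 V)) (by simp) 1 (by simp)
  have e : mappingCocone.descCochain (𝟙 V) (M := V) (m := -1) (n := 0)
      0 (Cochain.ofHom (𝟙 V)) (by simp) = mappingCocone.snd (𝟙 V) := by
    ext p q hpq
    have h := mappingCocone.id_X (𝟙 V) p q hpq
    rw [← Category.id_comp ((mappingCocone.descCochain _ _ _ _).v p q hpq), ← h,
      Preadditive.add_comp, Category.assoc, Category.assoc]
    simp
  rw [e] at h
  simp [h]

lemma nonempty_homotopy_zero_iff {W V : CochainComplex A ℤ} (f : W ⟶ V) :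
    Nonempty (Homotopy f 0) ↔ ∃ z : Cochain W V (-1), δ (-1) 0 z = Cochain.ofHom f := by
  constructor
  · rintro ⟨h⟩
    have := (Cochain.equivHomotopy _ _ h).2
    simp only [Cochain.ofHom_zero, add_zero] at this
    exact ⟨_, this.symm⟩
  · rintro ⟨z, hz⟩
    exact ⟨(Cochain.equivHomotopy _ _).symm ⟨z, by simp [hz]⟩⟩

/-- The null-homotopic morphisms `W ⟶ V` are those which lift to the path object of `V`. -/
lemma nonempty_homotopy_zero_iff_exists_lift {W V : CochainComplex A ℤ} (f : W ⟶ V) :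
    Nonempty (Homotopy f 0) ↔
      ∃ g : W ⟶ mappingCocone (𝟙 V), g ≫ mappingCocone.fst (𝟙 V) = f := by
  rw [nonempty_homotopy_zero_iff]
  constructor
  · rintro ⟨z, hz⟩
    exact ⟨mappingCocone.lift (𝟙 V) f (-z) (by simp [hz]), by simp⟩
  · rintro ⟨g, rfl⟩
    refine ⟨-(Cochain.ofHom g).comp (mappingCocone.snd (𝟙 V)) (by simp), ?_⟩
    simp [mappingCocone.δ_snd_id, Cochain.ofHom_comp]

/-- The null-homotopic morphisms `W ⟶ V` are those which extend to the cone of `W`. -/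
lemma nonempty_homotopy_zero_iff_exists_extension {W V : CochainComplex A ℤ} (f : W ⟶ V) :
    Nonempty (Homotopy f 0) ↔
      ∃ g : mappingCone (𝟙 W) ⟶ V, mappingCone.inr (𝟙 W) ≫ g = f := by
  rw [nonempty_homotopy_zero_iff]
  constructor
  · rintro ⟨z, hz⟩
    exact ⟨mappingCone.desc (𝟙 W) z f (by simp [hz]), by simp⟩
  · rintro ⟨g, rfl⟩
    refine ⟨(mappingCone.inl (𝟙 W)).comp (Cochain.ofHom g) (by simp), ?_⟩
    simp [Cochain.ofHom_comp]

/-- If all cocycles of degree `-1` from `P` to `V` are coboundaries, then the fibration from the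
path object of `V` to `V` has the right lifting property with respect to the inclusion of `P` in
its cone. -/
lemma hasLiftingProperty_inr_fst {P V : CochainComplex A ℤ}
    (h : ∀ x : Cocycle P V (-1), x ∈ coboundaries P V (-1)) :
    HasLiftingProperty (mappingCone.inr (𝟙 P)) (mappingCocone.fst (𝟙 V)) where
  sq_hasLift {a b} sq := by
    have hw := sq.w
    -- The square provides two null-homotopies of the same map, one from `b` on the cone and one, up
    -- to sign, from `a` in the path object. Their discrepancy `α + c` is a cocycle, and a primitive
    -- `γ` of it supplies the missing component of the lift.
    let α : Cochain P V (-1) := (mappingCone.inl (𝟙 P)).comp (Cochain.ofHom b) (by simp)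
    let c : Cochain P V (-1) := (Cochain.ofHom a).comp (mappingCocone.snd (𝟙 V)) (by simp)
    have hα : δ (-1) 0 α = Cochain.ofHom (a ≫ mappingCocone.fst (𝟙 V)) := by
      simp [α, hw, Cochain.ofHom_comp]
    have hc : δ (-1) 0 c = -Cochain.ofHom (a ≫ mappingCocone.fst (𝟙 V)) := by
      simp [c, mappingCocone.δ_snd_id, Cochain.ofHom_comp]
    obtain ⟨γ, hγ⟩ := (mem_coboundaries_iff _ (-2) (by simp)).1
      (h (Cocycle.mk (α + c) 0 (by simp) (by simp [hα, hc])))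
    simp only [Cocycle.mk_coe] at hγ
    have hβ := mappingCocone.δ_liftCochain (𝟙 V) α (-γ) (by simp) 0 (by simp)
    have ha : δ (-1) 0 (mappingCocone.liftCochain (𝟙 V) α (-γ) (by simp)) =
        Cochain.ofHom (𝟙 P ≫ a) := by
      rw [hβ, hα]
      ext p
      simp only [δ_neg, hγ]
      have hid := mappingCocone.id_X (𝟙 V) p (p + -1) rfl
      have hc' : (c.comp (mappingCocone.inr (𝟙 V)).1 (by simp)).v p p (add_zero p) =
          a.f p ≫ (mappingCocone.snd (𝟙 V)).v p (p + -1) rfl ≫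
            (mappingCocone.inr (𝟙 V)).1.v (p + -1) p (by simp) := by
        rw [Cochain.comp_v _ _ _ p (p + -1) p rfl (by simp)]
        simp [c]
      simp
      refine (congrArg (_ + ·) hc').trans ?_
      rw [← Preadditive.comp_add, hid, Category.comp_id]
    refine ⟨⟨⟨mappingCone.desc (𝟙 P) _ a ha, by simp, ?_⟩⟩⟩
    ext p
    apply mappingCone.ext_from _ (p + 1) p rfl
    · simp [α]
    · simpa using HomologicalComplex.congr_hom hw p

end Homotopies

/-! ### Morphisms out of K-projective complexes in the derived category. -/

section DerivedHoms

open CochainComplex CochainComplex.HomComplex DerivedCategory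

variable {A : Type u} [Category.{v} A] [Abelian A] [HasDerivedCategory.{w} A]

lemma exists_Q_map_eq (P K : CochainComplex A ℤ) [P.IsKProjective] (f : Q.obj P ⟶ Q.obj K) :
    ∃ φ : P ⟶ K, Q.map φ = f := by
  obtain ⟨g, hg⟩ := (IsKProjective.Qh_map_bijective P
    ((HomotopyCategory.quotient _ _).obj K)).2
      ((quotientCompQhIso A).hom.app P ≫ f ≫ (quotientCompQhIso A).inv.app K)
  obtain ⟨φ, rfl⟩ := (HomotopyCategory.quotient _ _).map_surjective g
  refine ⟨φ, ?_⟩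
  have h := quotientCompQhIso_hom_naturality φ
  rw [hg] at h
  simpa using h.symm

lemma Q_map_eq_zero_iff {P K : CochainComplex A ℤ} [P.IsKProjective] (φ : P ⟶ K) :
    Q.map φ = 0 ↔ Nonempty (Homotopy φ 0) := by
  refine ⟨fun h ↦ ?_, fun ⟨h⟩ ↦ by rw [Q_map_eq_of_homotopy _ h, Functor.map_zero]⟩
  rw [← HomotopyCategory.quotient_map_eq_zero_iff]
  apply (IsKProjective.Qh_map_bijective P _).1
  rw [← cancel_mono ((quotientCompQhIso A).hom.app K)]
  rw [quotientCompQhIso_hom_naturality, h]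
  simp

lemma mem_coboundaries_of_forall_eq_zero {P K : CochainComplex A ℤ} [P.IsKProjective] {m : ℤ}
    (h : ∀ f : Q.obj P ⟶ (Q.obj K)⟦m⟧, f = 0) (x : Cocycle P K m) :
    x ∈ coboundaries P K m := by
  rw [← CohomologyClass.toHom_mk_eq_zero_iff, CohomologyClass.toHom_mk,
    HomotopyCategory.quotient_map_eq_zero_iff, ← Q_map_eq_zero_iff,
    ← cancel_mono ((Q.commShiftIso m).hom.app K), zero_comp]
  exact h _

/-- The localization functor sends coproducts of K-projective complexes to coproducts. -/
lemma nonempty_isColimit_Q_cofan {J : Type*} {F : J → CochainComplex A ℤ}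
    [∀ j, (F j).IsKProjective] {c : Cofan F} (hc : IsColimit c) :
    Nonempty (IsColimit (Cofan.mk (Q.obj c.pt) (fun j ↦ Q.map (c.inj j)))) := by
  -- Null-homotopies are lifts to the path object, so the universal property of the coproduct glues
  -- those chosen on the summands.
  have glue {V : CochainComplex A ℤ} (φ : c.pt ⟶ V)
      (h : ∀ j, Nonempty (Homotopy (c.inj j ≫ φ) 0)) : Nonempty (Homotopy φ 0) := by
    simp only [nonempty_homotopy_zero_iff_exists_lift] at h ⊢
    choose g hg using h
    exact ⟨Cofan.IsColimit.desc hc g, Cofan.IsColimit.hom_ext hc _ _ (by simp [hg])⟩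
  have : c.pt.IsKProjective := ⟨fun φ hV ↦ glue φ
    (fun j ↦ IsKProjective.nonempty_homotopy_zero _ hV)⟩
  have hex (Y : DerivedCategory A) (f : ∀ j, Q.obj (F j) ⟶ Y) :
      ∃ g : Q.obj c.pt ⟶ Y, ∀ j, Q.map (c.inj j) ≫ g = f j := by
    let e := Q.objObjPreimageIso Y
    choose φ hφ using fun j ↦ exists_Q_map_eq _ _ (f j ≫ e.inv)
    refine ⟨Q.map (Cofan.IsColimit.desc hc φ) ≫ e.hom, fun j ↦ ?_⟩
    rw [← Functor.map_comp_assoc]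
    simp [hφ]
  have hun (Y : DerivedCategory A) (g : Q.obj c.pt ⟶ Y) (h : ∀ j, Q.map (c.inj j) ≫ g = 0) :
      g = 0 := by
    let e := Q.objObjPreimageIso Y
    obtain ⟨φ, hφ⟩ := exists_Q_map_eq _ _ (g ≫ e.inv)
    rw [← cancel_mono e.inv, ← hφ, zero_comp, Q_map_eq_zero_iff]
    exact glue _ (fun j ↦ by
      rw [← Q_map_eq_zero_iff, Functor.map_comp, hφ, reassoc_of% (h j), zero_comp])
  choose d hd using hex
  exact ⟨Cofan.IsColimit.mk _ (fun s ↦ d s.pt s.inj) (fun s j ↦ hd _ _ _) (fun s m hm ↦ by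
    rw [← sub_eq_zero]
    exact hun _ _ (fun j ↦ by
      have := hm j
      dsimp at this
      simp [this, hd]))⟩

end DerivedHoms

lemma CategoryTheory.Pretriangulated.distinguished_of_iso₂ {C : Type*} [Category C] [Preadditive C]
    [HasZeroObject C] [HasShift C ℤ] [∀ n : ℤ, (shiftFunctor C n).Additive]
    [Pretriangulated C] {T : Triangle C} (hT : T ∈ distTriang C) {X : C} (e : T.obj₂ ≅ X) :
    Triangle.mk (T.mor₁ ≫ e.hom) (e.inv ≫ T.mor₂) T.mor₃ ∈ distTriang C :=
  isomorphic_distinguished _ hT _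
    (Triangle.isoMk (Triangle.mk (T.mor₁ ≫ e.hom) (e.inv ≫ T.mor₂) T.mor₃) T (Iso.refl T.obj₁)
      e.symm (Iso.refl T.obj₃) 
      (by change (T.mor₁ ≫ e.hom) ≫ e.inv = 𝟙 T.obj₁ ≫ T.mor₁; simp)
      (by change (e.inv ≫ T.mor₂) ≫ 𝟙 T.obj₃ = e.inv ≫ T.mor₂; simp)
      (by change T.mor₃ ≫ (shiftFunctor C 1).map (𝟙 T.obj₁) = 𝟙 T.obj₃ ≫ T.mor₃; simp))

/-! ### Small object argument for families of monomorphisms. -/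

section SmallObject

open MorphismProperty IsGrothendieckAbelian HomotopicalAlgebra

/-- In a Grothendieck abelian category, any small family of monomorphisms permits the small object
argument. -/
lemma hasSmallObjectArgument_ofHoms {B : Type u} [Category.{v} B] [Abelian B]
    [IsGrothendieckAbelian.{t} B] {S : Type t} {X Y : S → B} (i : ∀ s, X s ⟶ Y s)
    [∀ s, Mono (i s)] : HasSmallObjectArgument.{t} (ofHoms i) := by
  have hi : ofHoms i ≤ monomorphisms B := by
    rintro _ _ _ ⟨s⟩
    exact inferInstanceAs (Mono (i s))
  -- Bounding the number of subobjects of each source by a regular `κ` makes maps out of it commute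
  -- with `κ`-indexed colimits of monomorphisms.
  obtain ⟨κ, hκ', hκ⟩ := HasCardinalLT.exists_regular_cardinal.{t} (Σ s, Subobject (X s))
  have : Fact κ.IsRegular := ⟨hκ'⟩
  have : Nonempty κ.ord.ToType := by simpa using hκ'.ne_zero
  have := WellFoundedLT.toOrderBot κ.ord.ToType
  exact ⟨κ, inferInstance, inferInstance,
    { preservesColimit {A B' X' Y'} j hj f hf := by
        let hf' : (monomorphisms B).TransfiniteCompositionOfShape κ.ord.ToType f :=
          { toTransfiniteCompositionOfShape := hf.toTransfiniteCompositionOfShape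
            map_mem j hj := by
              have := (hf.attachCells j hj).pushouts_coproducts
              simp only [ofHoms_homFamily] at this
              refine (?_ : _ ≤ monomorphisms B) _ this
              simp only [pushouts_le_iff, coproducts_le_iff]
              exact hi }
        have (j j' : κ.ord.ToType) (φ : j ⟶ j') : Mono (hf'.F.map φ) := hf'.mem_map φ
        apply preservesColimit_coyoneda_obj_of_mono (Y := hf'.F) (κ := κ)
        obtain ⟨s⟩ := hj
        exact hκ.of_injective (fun Z ↦ ⟨s, Z⟩) (fun _ _ h ↦ by simpa using h) }⟩

end SmallObject

/-! ### Torsion pairs generated by a set of K-projective complexes. -/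

section Torsion

open CochainComplex CochainComplex.HomComplex DerivedCategory MorphismProperty ZeroObject

variable {A : Type u} [Category.{v} A] [Abelian A]

lemma CochainComplex.mappingCone.mono_inr {K L : CochainComplex A ℤ} (f : K ⟶ L) :
    Mono (mappingCone.inr f) := by
  have (p : ℤ) : Mono ((mappingCone.inr f).f p) :=
    mono_of_mono_fac (mappingCone.inr_f_snd_v f p)
  exact HomologicalComplex.mono_of_mono_f _ this

lemma isZero_Q_obj [HasDerivedCategory.{w} A] {V : CochainComplex A ℤ} (hV : V.Acyclic) :
    IsZero (Q.obj V) := by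
  have : IsIso (Q.map (0 : V ⟶ V)) := by
    rw [isIso_Q_map_iff_quasiIso, quasiIso_iff]
    exact fun i ↦ (quasiIsoAt_iff_exactAt _ i (hV i)).2 (hV i)
  rw [IsZero.iff_id_eq_zero, ← cancel_epi (Q.map (0 : V ⟶ V)), Functor.map_zero, zero_comp,
    zero_comp]

/-- Given a small family of K-projective complexes `P s`, any object `X` of the derived category
fits in a distinguished triangle `U ⟶ X ⟶ V ⟶ U⟦1⟧` where `V` is right orthogonal to all `P s`,
and `U` is left orthogonal to all the objects that are right orthogonal to all `P s`. -/
theorem exists_triangle_of_isKProjective [HasDerivedCategory.{w} A]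
    [IsGrothendieckAbelian.{t} (CochainComplex A ℤ)]
    {S : Type t} (P : S → CochainComplex A ℤ) [∀ s, (P s).IsKProjective]
    (X : DerivedCategory A) :
    ∃ (U V : DerivedCategory A) (f : U ⟶ X) (g : X ⟶ V) (h : V ⟶ U⟦(1 : ℤ)⟧),
      Triangle.mk f g h ∈ distTriang _ ∧ (∀ s (a : Q.obj (P s) ⟶ V), a = 0) ∧
      ∀ (W : DerivedCategory A), (∀ s (a : Q.obj (P s) ⟶ W), a = 0) →
        ∀ b : U ⟶ W, b = 0 := by
  let i (s : S) := mappingCone.inr (𝟙 (P s))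
  have (s : S) : Mono (i s) := mappingCone.mono_inr _
  have := hasSmallObjectArgument_ofHoms i
  let K := Q.objPreimage X
  let e : Q.obj K ≅ X := Q.objObjPreimageIso X
  let fac := factorizationData (ofHoms i).rlp.llp (ofHoms i).rlp (0 : K ⟶ 0)
  let L := fac.Z
  let j : K ⟶ L := fac.i
  have hj : (ofHoms i).rlp.llp j := fac.hi
  have hL : (ofHoms i).rlp (0 : L ⟶ 0) := by
    have := fac.hp
    rwa [(isZero_zero _).eq_of_tgt fac.p 0] at this
  have rlp_zero {Z : CochainComplex A ℤ}
      (hZ : ∀ s (φ : P s ⟶ Z), Nonempty (Homotopy φ 0)) : (ofHoms i).rlp (0 : Z ⟶ 0) := by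
    rintro _ _ _ ⟨s⟩
    refine ⟨fun {a b} sq ↦ ?_⟩
    obtain ⟨g, hg⟩ := (nonempty_homotopy_zero_iff_exists_extension a).1 (hZ s a)
    exact ⟨⟨⟨g, hg, (isZero_zero _).eq_of_tgt _ _⟩⟩⟩
  -- The cone of the identity is contractible, so its map to zero has the lifting property; the
  -- inclusion of `K` in it therefore extends along `j`.
  have : Mono j := by
    have h0 : (ofHoms i).rlp (0 : mappingCone (𝟙 K) ⟶ 0) := rlp_zero (fun s φ ↦ by
      have h : Nonempty (Homotopy (𝟙 (mappingCone (𝟙 K))) 0) :=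
        ⟨mappingCone.liftHomotopy _ _ _ (mappingCone.snd _) 0 (by simp) (by simp)⟩
      obtain ⟨h⟩ := h
      exact ⟨(Homotopy.ofEq (by simp)).trans ((h.compLeft φ).trans (Homotopy.ofEq (by simp)))⟩)
    have := hj _ h0
    have sq : CommSq (mappingCone.inr (𝟙 K)) j (0 : mappingCone (𝟙 K) ⟶ 0) 0 := ⟨by simp⟩
    have := mappingCone.mono_inr (𝟙 K)
    exact mono_of_mono_fac sq.fac_left
  -- Since `j` lifts against the path fibration of `V`, the map `cokernel.π j ≫ φ` lifts to the path
  -- object by a map vanishing on `K`. The lift descends to the cokernel and is a null-homotopy of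
  -- `φ`. Acyclic `V` satisfy the hypothesis, whence K-projectivity of the cokernel.
  have hC {V : CochainComplex A ℤ} (hV : ∀ s (a : Q.obj (P s) ⟶ (Q.obj V)⟦(-1 : ℤ)⟧), a = 0)
      (φ : cokernel j ⟶ V) : Nonempty (Homotopy φ 0) := by
    have hp : (ofHoms i).rlp (mappingCocone.fst (𝟙 V)) := by
      rintro _ _ _ ⟨s⟩
      exact hasLiftingProperty_inr_fst (mem_coboundaries_of_forall_eq_zero (hV s))
    have := hj _ hp
    have sq : CommSq 0 j (mappingCocone.fst (𝟙 V)) (cokernel.π j ≫ φ) := ⟨by simp⟩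
    rw [nonempty_homotopy_zero_iff_exists_lift]
    exact ⟨cokernel.desc j sq.lift (by simp), by
      rw [← cancel_epi (cokernel.π j)]
      simp⟩
  have : (cokernel j).IsKProjective := ⟨fun {V} φ hV ↦ hC (fun s a ↦ by
    exact ((CategoryTheory.shiftFunctor _ (-1 : ℤ)).map_isZero (isZero_Q_obj hV)).eq_of_tgt _ _) φ⟩
  have hS : (ShortComplex.mk _ _ (cokernel.condition j)).ShortExact :=
    { exact := ShortComplex.exact_cokernel j }
  have hT := triangleOfSES_distinguished hS
  have hT' := inv_rot_of_distTriang _ hT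
  refine ⟨_, Q.obj L, _, _, _, distinguished_of_iso₂ hT' e, ?_, ?_⟩
  · intro s a
    obtain ⟨φ, rfl⟩ := exists_Q_map_eq _ _ a
    rw [Q_map_eq_zero_iff, nonempty_homotopy_zero_iff_exists_extension]
    have := hL _ ⟨s⟩
    have sq : CommSq φ (i s) (0 : L ⟶ 0) 0 := ⟨by simp⟩
    exact ⟨_, sq.fac_left⟩
  · intro W hW b
    -- The object `U` is the cokernel of `j` shifted by -1, so maps from `U` to `W` are maps from
    -- the cokernel to `W⟦1⟧`.
    let V := Q.objPreimage (W⟦(1 : ℤ)⟧)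
    let e' : Q.obj V ≅ W⟦(1 : ℤ)⟧ := Q.objObjPreimageIso _
    let e'' : (Q.obj V)⟦(-1 : ℤ)⟧ ≅ W := (CategoryTheory.shiftFunctor _ (-1 : ℤ)).mapIso e' ≪≫
      (shiftFunctorCompIsoId _ (1 : ℤ) (-1) (by simp)).app W
    have hV (s) (a : Q.obj (P s) ⟶ (Q.obj V)⟦(-1 : ℤ)⟧) : a = 0 := by
      rw [← cancel_mono e''.hom, zero_comp]
      exact hW _ _
    have h0 (c : Q.obj (cokernel j) ⟶ Q.obj V) : c = 0 := by
      obtain ⟨φ, rfl⟩ := exists_Q_map_eq _ _ c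
      rw [Q_map_eq_zero_iff]
      exact hC hV φ
    rw [← cancel_mono e''.inv, zero_comp]
    obtain ⟨c, hc⟩ := (CategoryTheory.shiftFunctor (DerivedCategory A) (-1 : ℤ)).map_surjective (b ≫ e''.inv)
    exact hc.symm.trans ((congrArg _ (h0 c)).trans
      ((CategoryTheory.shiftFunctor (DerivedCategory A) (-1 : ℤ)).map_zero _ _))

end Torsion

/-! ### Projective resolutions of bounded above complexes, by duality. -/

section ProjectiveResolutions

open CochainComplex Opposite

variable {A : Type u} [Category.{v} A] [Abelian A]

lemma CochainComplex.quasiIso_of_op {K L : CochainComplex A ℤ} (f : K ⟶ L)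
    (hf : QuasiIso ((opEquivalence A).functor.map f.op)) : QuasiIso f := by
  rw [quasiIso_iff]
  intro m
  obtain ⟨k, rfl⟩ : ∃ k, m = -k := ⟨-m, by simp⟩
  rw [quasiIsoAt_iff' f (-(k + 1)) (-k) (-(k - 1)) (by simp; lia) (by simp; lia),
    ← ShortComplex.quasiIso_opMap_iff]
  have h := (quasiIso_iff _).1 hf k
  rw [quasiIsoAt_iff' _ (k - 1) k (k + 1) (by simp) (by simp)] at h
  exact h

/-- A bounded above complex in an abelian category with enough projectives has a projective
resolution with the same bound. -/
lemma CochainComplex.exists_quasiIso_projective [EnoughProjectives A] (K : CochainComplex A ℤ)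
    (d : ℤ) [K.IsStrictlyLE d] :
    ∃ (L : CochainComplex A ℤ) (f : L ⟶ K), QuasiIso f ∧ (∀ i, Projective (L.X i)) ∧
      L.IsStrictlyLE d := by
  let E := opEquivalence A
  let K' := E.functor.obj (op K)
  have : K'.IsStrictlyGE (-d) := by
    rw [isStrictlyGE_iff]
    intro i hi
    exact (K.isZero_of_isStrictlyLE d (-i) (by lia)).op
  obtain ⟨L', i, hi, hL', _⟩ := Plus.modelCategoryQuillen.exists_quasiIso_injective K' (-d)
  let L : CochainComplex A ℤ := (E.inverse.obj L').unop
  let f : L ⟶ K := (E.unitIso.hom.app (op K) ≫ E.inverse.map i).unop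
  have hf : E.functor.map f.op = i ≫ (E.counitIso.app L').inv := by
    have := E.functor_unitIso_comp (op K)
    simp [f]
  refine ⟨L, f, ?_, ?_, ?_⟩
  · apply quasiIso_of_op
    change QuasiIso (E.functor.map f.op)
    rw [hf]
    infer_instance
  · intro n
    have := hL' (-n)
    exact inferInstanceAs (Projective (unop (L'.X (-n))))
  · rw [isStrictlyLE_iff]
    intro j hj
    exact (L'.isZero_of_isStrictlyGE (-d) (-j) (by lia)).unop

end ProjectiveResolutions

/-! ### Formal closure properties of suspended subcategories. -/

namespace IsSuspendedWithSums

variable {C : Type u} [Category.{v} C] [Preadditive C] [HasZeroObject C] [HasShift C ℤ]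
  [∀ n : ℤ, (shiftFunctor C n).Additive] [Pretriangulated C] {P : ObjectProperty C}
  (hP : IsSuspendedWithSums.{t} P)

include hP

/-- An isomorphism exhibits its target as a coproduct with one term. In the same way, zero objects
come from the empty coproduct. -/
lemma of_iso {X Y : C} (e : X ≅ Y) (hX : P X) : P Y := by
  have hc : IsColimit (Cofan.mk Y (fun (_ : PUnit.{t + 1}) ↦ e.hom)) :=
    Cofan.IsColimit.mk _ (fun s ↦ e.inv ≫ s.inj ⟨⟩) (by simp) (fun s m hm ↦ by
      rw [Iso.eq_inv_comp]
      exact hm ⟨⟩)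
  exact hP.sum _ _ _ ⟨hc⟩ (fun _ ↦ hX)

lemma of_isZero {X : C} (hX : IsZero X) : P X := by
  have hc : IsColimit (Cofan.mk (f := fun (x : PEmpty.{t + 1}) ↦ (x.elim : C)) X
      (fun x ↦ x.elim)) :=
    Cofan.IsColimit.mk _ (fun s ↦ 0) (fun s x ↦ x.elim) (fun s m hm ↦ hX.eq_of_src _ _)
  exact hP.sum _ _ _ ⟨hc⟩ (fun x ↦ x.elim)

lemma shift_of_nonneg {X : C} (hX : P X) (j : ℤ) (hj : 0 ≤ j) : P (X⟦j⟧) := by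
  obtain rfl | hj := hj.eq_or_lt
  · exact hP.of_iso ((shiftFunctorZero C ℤ).app X).symm hX
  · exact hP.shift _ _ hj hX

lemma ext₃ {T : Triangle C} (hT : T ∈ distTriang C) (h₁ : P T.obj₁) (h₂ : P T.obj₂) :
    P T.obj₃ :=
  hP.ext _ (rot_of_distTriang _ hT) h₂ (hP.shift _ _ (by simp) h₁)

end IsSuspendedWithSums

namespace Susp

variable {C : Type u} [Category.{v} C] [Preadditive C] [HasZeroObject C] [HasShift C ℤ]
  [∀ n : ℤ, (shiftFunctor C n).Additive] [Pretriangulated C]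

lemma isSuspendedWithSums (E : C) : IsSuspendedWithSums.{t} (Susp.{t} E) where
  ext S hS h₁ h₃ P hP hE := hP.ext S hS (h₁ P hP hE) (h₃ P hP hE)
  shift X j hj h P hP hE := hP.shift X j hj (h P hP hE)
  sum J F c hc h P hP hE := hP.sum J F c hc (fun j ↦ h j P hP hE)

lemma self (E : C) : Susp.{t} E E := fun _ _ h ↦ h

end Susp

/-! ### Direct sums of copies, in modules and in the derived category. -/

namespace ModuleCat

variable {S : Type u} [Ring S]

/-- The functor which sends a module to the direct sum of copies of it indexed by `α`. -/
noncomputable abbrev finsuppFunctor (α : Type u) : ModuleCat.{u} S ⥤ ModuleCat.{u} S where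
  obj M := of S (α →₀ M)
  map f := ofHom (Finsupp.mapRange.linearMap f.hom)
  map_id M := by ext x; simp
  map_comp f g := by ext; simp

instance (α : Type u) : (finsuppFunctor (S := S) α).Additive where
  map_add := by intros; ext; simp

instance (α : Type u) : (finsuppFunctor (S := S) α).PreservesHomology := by
  refine ((finsuppFunctor (S := S) α).exact_tfae.out 1 2).1 fun K hK ↦ ?_
  rw [ShortComplex.moduleCat_exact_iff] at hK ⊢
  intro (x : α →₀ K.X₂) (hx : Finsupp.mapRange.linearMap K.g.hom x = 0)
  classical
  have h (a : α) : ∃ y : K.X₁, K.f.hom y = x a :=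
    hK _ (by simpa using congr($hx a))
  choose y hy using h
  refine ⟨Finsupp.onFinset x.support (fun a ↦ if x a = 0 then 0 else y a) (by simp +contextual), ?_⟩
  refine Finsupp.ext (fun a ↦ ?_)
  change K.f.hom (if x a = 0 then 0 else y a) = x a
  by_cases ha : x a = 0 <;> simp [ha, hy]

lemma ofHom_lsingle_naturality {M N : ModuleCat.{u} S} (f : M ⟶ N) {α : Type u} (a : α) :
    ofHom (Finsupp.lsingle a) ≫ (finsuppFunctor α).map f = f ≫ ofHom (Finsupp.lsingle a) := by
  refine ModuleCat.hom_ext (LinearMap.ext fun x ↦ ?_)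
  change Finsupp.mapRange.linearMap f.hom (Finsupp.single a x) = Finsupp.single a (f.hom x)
  simp

lemma ofHom_lsingle_naturality_assoc {M N : ModuleCat.{u} S} (f : M ⟶ N) {α : Type u} (a : α)
    {Z : ModuleCat.{u} S} (h : (finsuppFunctor α).obj N ⟶ Z) :
    ofHom (Finsupp.lsingle a) ≫ (finsuppFunctor α).map f ≫ h =
      f ≫ ofHom (Finsupp.lsingle a) ≫ h := by
  rw [← Category.assoc, ofHom_lsingle_naturality, Category.assoc]

/-- The direct sum of copies of a module, as a coproduct. -/
lemma nonempty_isColimit_finsupp (M : ModuleCat.{u} S) (α : Type u) :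
    Nonempty (IsColimit (Cofan.mk (f := fun _ : α ↦ M) (of S (α →₀ M))
      (fun a ↦ ofHom (Finsupp.lsingle a)))) :=
  ⟨Cofan.IsColimit.mk _
    (fun s ↦ ofHom (Finsupp.lsum ℕ (fun a ↦ (s.inj a).hom)))
    (fun s a ↦ by ext x; simp)
    (fun s m hm ↦ by
      refine ModuleCat.hom_ext (Finsupp.lhom_ext fun a x ↦ ?_)
      simpa using congr($(hm a) x))⟩

end ModuleCat

section Sums

open CochainComplex DerivedCategory

variable {S : Type u} [Ring S] [HasDerivedCategory.{w} (ModuleCat.{u} S)]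

/-- The localization functor sends the termwise direct sum of copies of a bounded above complex
of modules to a coproduct. -/
lemma nonempty_isColimit_Q_finsupp (K : CochainComplex (ModuleCat.{u} S) ℤ) (d : ℤ)
    [K.IsStrictlyLE d] (α : Type u) {K' : CochainComplex (ModuleCat.{u} S) ℤ}
    (e : ((ModuleCat.finsuppFunctor α).mapHomologicalComplex _).obj K ≅ K')
    (j : α → (K ⟶ K'))
    (hj : ∀ a i, (j a).f i = ModuleCat.ofHom (Finsupp.lsingle a) ≫ e.hom.f i) :
    Nonempty (IsColimit (Cofan.mk (f := fun _ : α ↦ Q.obj K) (Q.obj K') (fun a ↦ Q.map (j a)))) := by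
  let Φ := ModuleCat.finsuppFunctor (S := S) α
  -- For the K-projective `L` the termwise sum is a coproduct in the derived category. Direct sums
  -- of modules are exact, so the sum of copies of `π` is again a quasi-isomorphism.
  obtain ⟨L, π, hπ, _, _⟩ := exists_quasiIso_projective K d
  have := isKProjective_of_projective L d
  let ΦL := (Φ.mapHomologicalComplex _).obj L
  let ι (a : α) : L ⟶ ΦL :=
    { f i := ModuleCat.ofHom (Finsupp.lsingle a)
      comm' i k _ := by
        exact ModuleCat.ofHom_lsingle_naturality _ _ }
  let c : Cofan (fun _ : α ↦ L) := Cofan.mk ΦL ι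
  have hc : IsColimit c := by
    refine HomologicalComplex.isColimitOfEval _ _ (fun i ↦ ?_)
    exact (isColimitMapCoconeCofanMkEquiv _ _ _).2
      (ModuleCat.nonempty_isColimit_finsupp (L.X i) α).some
  let p : ΦL ⟶ K' := (Φ.mapHomologicalComplex _).map π ≫ e.hom
  have hp : QuasiIso p := by
    have : QuasiIso ((Φ.mapHomologicalComplex (ComplexShape.up ℤ)).map π) := inferInstance
    infer_instance
  have hι (a : α) : ι a ≫ p = π ≫ j a := by
    ext i : 1
    exact (ModuleCat.ofHom_lsingle_naturality_assoc (π.f i) a (e.hom.f i)).trans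
      congr(π.f i ≫ $(hj a i)).symm
  have hι' (a : α) : Q.map (ι a) ≫ Q.map p = Q.map π ≫ Q.map (j a) := by
    rw [← Q.map_comp, hι, Q.map_comp]
  obtain ⟨h⟩ := nonempty_isColimit_Q_cofan hc
  refine ⟨Cofan.IsColimit.mk _ (fun s ↦ inv (Q.map p) ≫
    Cofan.IsColimit.desc h (fun a ↦ Q.map π ≫ s.inj a)) ?_ ?_⟩
  · intro s a
    rw [← cancel_epi (Q.map π)]
    have := Cofan.IsColimit.fac h (fun a ↦ Q.map π ≫ s.inj a) a
    change Q.map (ι a) ≫ _ = _ at this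
    rw [← this]
    change Q.map π ≫ Q.map (j a) ≫ _ = _
    rw [← reassoc_of% hι' a]
    simp
  · intro s m hm
    rw [IsIso.eq_inv_comp]
    refine Cofan.IsColimit.hom_ext h _ _ (fun a ↦ ?_)
    rw [Cofan.IsColimit.fac, ← hm]
    change Q.map (ι a) ≫ _ = _ ≫ Q.map (j a) ≫ _
    rw [reassoc_of% hι' a]

/-- The embedding of modules in the derived category preserves direct sums of copies. -/
lemma nonempty_isColimit_singleFunctor_finsupp (M : ModuleCat.{u} S) (α : Type u) :
    Nonempty (IsColimit (Cofan.mk (f := fun _ : α ↦ (DerivedCategory.singleFunctor _ 0).obj M)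
      ((DerivedCategory.singleFunctor _ 0).obj (ModuleCat.of S (α →₀ M)))
      (fun a ↦ (DerivedCategory.singleFunctor _ 0).map (ModuleCat.ofHom (Finsupp.lsingle a))))) :=
  nonempty_isColimit_Q_finsupp ((CochainComplex.singleFunctor (ModuleCat.{u} S) 0).obj M) 0 α
    ((HomologicalComplex.singleMapHomologicalComplex (ModuleCat.finsuppFunctor α) _ 0).app M)
    (fun a ↦ (CochainComplex.singleFunctor (ModuleCat.{u} S) 0).map
      (ModuleCat.ofHom (Finsupp.lsingle a))) (by
      intro a i
      by_cases hi : i = 0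
      · subst hi
        dsimp
        rw [HomologicalComplex.singleMapHomologicalComplex_hom_app_self]
        erw [HomologicalComplex.single_map_f_self]
        exact (ModuleCat.ofHom_lsingle_naturality_assoc _ a _).symm
      · exact (HomologicalComplex.isZero_single_obj_X _ _ _ _ hi).eq_of_tgt _ _)

end Sums

/-! ### The mapping telescope of an idempotent. -/

section Telescope

variable {S M F : Type*} [Ring S] [AddCommGroup M] [Module S M] [AddCommGroup F] [Module S F]

/-- The endomorphism of a countable direct sum of copies of `F` whose cokernel is the sequential
colimit of the iterates of `e`. -/
noncomputable def telescope (e : F →ₗ[S] F) : (ℕ →₀ F) →ₗ[S] (ℕ →₀ F) :=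
  Finsupp.lsum ℕ (fun l ↦ Finsupp.lsingle l - (Finsupp.lsingle (l + 1)).comp e)

/-- The map given by `r` on each summand of a countable direct sum of copies of `F`. -/
noncomputable def telescopeSum (r : F →ₗ[S] M) : (ℕ →₀ F) →ₗ[S] M :=
  Finsupp.lsum ℕ (fun _ ↦ r)

@[simp]
lemma telescope_single (e : F →ₗ[S] F) (l : ℕ) (x : F) :
    telescope e (Finsupp.single l x) = Finsupp.single l x - Finsupp.single (l + 1) (e x) := by
  simp [telescope]

@[simp]
lemma telescopeSum_single (r : F →ₗ[S] M) (l : ℕ) (x : F) :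
    telescopeSum r (Finsupp.single l x) = r x := by
  simp [telescopeSum]

/-- The map between countable direct sums of copies which is `f` from each summand to the next
one. -/
noncomputable def finsuppSucc (f : F →ₗ[S] M) : (ℕ →₀ F) →ₗ[S] (ℕ →₀ M) :=
  Finsupp.lsum ℕ (fun l ↦ (Finsupp.lsingle (l + 1)).comp f)

@[simp]
lemma finsuppSucc_single (f : F →ₗ[S] M) (l : ℕ) (x : F) :
    finsuppSucc f (Finsupp.single l x) = Finsupp.single (l + 1) (f x) := by
  simp [finsuppSucc]

lemma telescope_apply_zero (e : F →ₗ[S] F) (z : ℕ →₀ F) : telescope e z 0 = z 0 := by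
  induction z using Finsupp.induction_linear with
  | zero => simp
  | add f g hf hg => simp [hf, hg]
  | single l x => simp [Finsupp.single_apply]

lemma telescope_apply_succ (e : F →ₗ[S] F) (z : ℕ →₀ F) (l : ℕ) :
    telescope e z (l + 1) = z (l + 1) - e (z l) := by
  induction z using Finsupp.induction_linear with
  | zero => simp
  | add f g hf hg => simp [hf, hg]; abel
  | single l x => simp [Finsupp.single_apply]; split_ifs <;> simp

lemma telescope_injective (e : F →ₗ[S] F) : Function.Injective (telescope e) := by
  rw [injective_iff_map_eq_zero]
  intro z hz
  ext l
  induction l with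
  | zero => simpa [telescope_apply_zero] using congr($hz 0)
  | succ l hl =>
    simp only [Finsupp.coe_zero, Pi.zero_apply] at hl
    simpa [telescope_apply_succ, hl] using congr($hz (l + 1))

variable {i : M →ₗ[S] F} {r : F →ₗ[S] M}

lemma telescopeSum_surjective (h : r ∘ₗ i = LinearMap.id) :
    Function.Surjective (telescopeSum r) :=
  fun x ↦ ⟨Finsupp.single 0 (i x), by simpa using congr($h x)⟩

lemma telescope_exact (h : r ∘ₗ i = LinearMap.id) :
    Function.Exact (telescope (i ∘ₗ r)) (telescopeSum r) := by
  have h' (x : M) : r (i x) = x := congr($h x)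
  have h₀ (z : ℕ →₀ F) : telescopeSum r (telescope (i ∘ₗ r) z) = 0 := by
    induction z using Finsupp.induction_linear with
    | zero => simp
    | add f g hf hg => simp [hf, hg]
    | single l x => simp [h']
  -- Modulo the image, any element can be pushed to the right until it is concentrated in one far
  -- position `m`, where it is determined by its image under `telescopeSum r`.
  have h₁ (z : ℕ →₀ F) : ∃ N, ∀ m ≥ N,
      z - Finsupp.single m (i (telescopeSum r z)) ∈ LinearMap.range (telescope (i ∘ₗ r)) := by
    induction z using Finsupp.induction_linear with
    | zero => exact ⟨0, by simp⟩
    | add f g hf hg =>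
      obtain ⟨N, hN⟩ := hf
      obtain ⟨N', hN'⟩ := hg
      refine ⟨max N N', fun m hm ↦ ?_⟩
      convert add_mem (hN m (by simp at hm; lia)) (hN' m (by simp at hm; lia)) using 1
      simp
      abel
    | single l x =>
      refine ⟨l + 1, fun m hm ↦ ?_⟩
      induction m, hm using Nat.le_induction with
      | base => exact ⟨Finsupp.single l x, by simp⟩
      | succ m hm ih =>
        convert add_mem ih ⟨Finsupp.single m (i (r x)), rfl⟩ using 1
        simp [h']
  intro z
  refine ⟨fun hz ↦ ?_, ?_⟩
  · obtain ⟨N, hN⟩ := h₁ z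
    simpa [hz] using hN N le_rfl
  · rintro ⟨y, rfl⟩
    exact h₀ y

end Telescope

lemma ModuleCat.shortExact_of_exact {S : Type u} [Ring S] (K : ShortComplex (ModuleCat.{v} S))
    (h₁ : Function.Injective K.f) (h₂ : Function.Exact K.f K.g) (h₃ : Function.Surjective K.g) :
    K.ShortExact where
  exact := (ShortComplex.ShortExact.moduleCat_exact_iff_function_exact K).2 h₂
  mono_f := (ModuleCat.mono_iff_injective _).2 h₁
  epi_g := (ModuleCat.epi_iff_surjective _).2 h₃

/-! ### Direct summands and projectives in suspended subcategories. -/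

section Summands

variable {S : Type u} [Ring S] [HasDerivedCategory.{w} (ModuleCat.{u} S)]

namespace IsSuspendedWithSums

variable {P : ObjectProperty (DerivedCategory (ModuleCat.{u} S))} (hP : IsSuspendedWithSums.{u} P)

include hP

lemma single_finsupp {M : ModuleCat.{u} S} (hM : P ((DerivedCategory.singleFunctor _ 0).obj M))
    (α : Type u) : P ((DerivedCategory.singleFunctor _ 0).obj (ModuleCat.of S (α →₀ M))) :=
  hP.sum _ _ _ (nonempty_isColimit_singleFunctor_finsupp M α) (fun _ ↦ hM)

/-- Closure under summands is not an axiom. The telescope of the idempotent of `F` presents `M` as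
the cone of a map between countable sums of copies of `F`. -/
lemma single_of_retract {M F : ModuleCat.{u} S} (h : Retract M F)
    (hF : P ((DerivedCategory.singleFunctor _ 0).obj F)) :
    P ((DerivedCategory.singleFunctor _ 0).obj M) := by
  have hir : h.r.hom ∘ₗ h.i.hom = LinearMap.id := by
    rw [← ModuleCat.hom_comp, h.retract, ModuleCat.hom_id]
  let K : ShortComplex (ModuleCat.{u} S) :=
    ShortComplex.mk (ModuleCat.ofHom (telescope (h.i.hom ∘ₗ h.r.hom)))
      (ModuleCat.ofHom (telescopeSum h.r.hom))
      (ModuleCat.hom_ext (LinearMap.ext (telescope_exact hir).apply_apply_eq_zero))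
  have hK : K.ShortExact := ModuleCat.shortExact_of_exact _ (telescope_injective _)
    (telescope_exact hir) (telescopeSum_surjective hir)
  have hN : P ((DerivedCategory.singleFunctor _ 0).obj (ModuleCat.of S (ℕ →₀ F))) :=
    hP.of_iso ((DerivedCategory.singleFunctor _ 0).mapIso
      (LinearEquiv.toModuleIso (Finsupp.domLCongr Equiv.ulift)))
      (hP.single_finsupp hF (ULift.{u} ℕ))
  exact hP.ext₃ hK.singleTriangle_distinguished hN hN

lemma single_of_projective (hS : P ((DerivedCategory.singleFunctor _ 0).obj (ModuleCat.of S S)))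
    (M : ModuleCat.{u} S) [Projective M] : P ((DerivedCategory.singleFunctor _ 0).obj M) := by
  have : Module.Projective S M := (IsProjective.iff_projective M).2 inferInstance
  obtain ⟨s, hs⟩ := Module.projective_def'.1 this
  exact hP.single_of_retract (F := ModuleCat.of S (M →₀ S))
    ⟨ModuleCat.ofHom s, ModuleCat.ofHom (Finsupp.linearCombination S id),
      ModuleCat.hom_ext hs⟩ (hP.single_finsupp hS M)

lemma single_neg {M : ModuleCat.{u} S} (hM : P ((DerivedCategory.singleFunctor _ 0).obj M))
    (k : ℕ) : P ((DerivedCategory.singleFunctor _ (-k)).obj M) := by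
  refine hP.of_iso ?_ (hP.shift_of_nonneg hM k (by lia))
  exact ((DerivedCategory.singleFunctors _).shiftIso (k : ℤ) (-k) 0 (by simp)).app M

end IsSuspendedWithSums

end Summands

/-! ### A complex in nonpositive degrees as the colimit of its stupid truncations. -/

namespace CochainComplex

variable {S : Type u} [Ring S] (K : CochainComplex (ModuleCat.{u} S) ℤ)

lemma d_d_apply (i j l : ℤ) (x : K.X i) : (K.d j l).hom ((K.d i j).hom x) = 0 :=
  congr(ModuleCat.Hom.hom $(K.d_comp_d i j l) x)

/-- The terms of the stupid truncation of a complex of modules in degrees `> -k`. -/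
def brutalSubmodule (k : ℕ) (i : ℤ) : Submodule S (K.X i) where
  carrier := {x | i + k ≤ 0 → x = 0}
  add_mem' hx hy h := by rw [hx h, hy h, add_zero]
  zero_mem' _ := rfl
  smul_mem' a x hx h := by rw [hx h, smul_zero]

variable {K} in
lemma mem_brutalSubmodule_iff {k : ℕ} {i : ℤ} {x : K.X i} :
    x ∈ brutalSubmodule K k i ↔ (i + k ≤ 0 → x = 0) := Iff.rfl

lemma d_mem_brutalSubmodule (k : ℕ) (i j : ℤ) (x : K.X i) (hx : x ∈ brutalSubmodule K k i) :
    (K.d i j).hom x ∈ brutalSubmodule K k j := by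
  intro hj
  by_cases h : i + 1 = j
  · rw [hx (by lia), map_zero]
  · rw [K.shape i j h]
    rfl

/-- The stupid truncation of a complex of modules in degrees `> -k`. -/
noncomputable def brutal (k : ℕ) : CochainComplex (ModuleCat.{u} S) ℤ where
  X i := ModuleCat.of S (brutalSubmodule K k i)
  d i j := ModuleCat.ofHom ((K.d i j).hom.restrict (d_mem_brutalSubmodule K k i j))
  shape i j h := by
    refine ModuleCat.hom_ext (LinearMap.ext fun x ↦ Subtype.ext ?_)
    change (K.d i j).hom x.1 = 0
    rw [K.shape i j h]
    rfl
  d_comp_d' i j l _ _ := by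
    exact ModuleCat.hom_ext (LinearMap.ext fun x ↦ Subtype.ext (K.d_d_apply i j l x.1))

/-- The inclusion of a stupid truncation in the next one. -/
noncomputable def brutalSucc (k : ℕ) : K.brutal k ⟶ K.brutal (k + 1) where
  f i := ModuleCat.ofHom (Submodule.inclusion (fun x hx h ↦ hx (by simp at h; lia)))
  comm' i j _ := rfl

/-- The direct sum of all the stupid truncations in degrees `> -k` of a complex of modules which
vanishes in positive degrees: in degree `i` the `l`-th copy of `K.X i` comes from the truncation in
degrees `> i - l - 1`. -/
noncomputable def brutalSum : CochainComplex (ModuleCat.{u} S) ℤ where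
  X i := ModuleCat.of S (ℕ →₀ K.X i)
  -- The `k`-th truncation sits at index `k + i - 1` in degree `i`, so for fixed `k` the
  -- differential raises the index by one. With this indexing every degree carries a full direct sum
  -- over `ℕ`.
  d i j := ModuleCat.ofHom (finsuppSucc (K.d i j).hom)
  shape i j h := by
    refine ModuleCat.hom_ext (Finsupp.lhom_ext fun l x ↦ ?_)
    simp [K.shape i j h]
  d_comp_d' i j l _ _ := by
    refine ModuleCat.hom_ext (Finsupp.lhom_ext fun l x ↦ ?_)
    simp [K.d_d_apply]

/-- The inclusion of a stupid truncation in the direct sum of all of them. -/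
noncomputable def brutalι (k : ℕ) : K.brutal k ⟶ K.brutalSum where
  f i := ModuleCat.ofHom ((Finsupp.lsingle (k + i - 1).toNat).comp (brutalSubmodule K k i).subtype)
  comm' i j hij := by
    refine ModuleCat.hom_ext (LinearMap.ext fun ⟨x, hx⟩ ↦ ?_)
    refine (finsuppSucc_single _ _ x).trans ?_
    change _ = Finsupp.single _ ((K.d i j).hom x)
    have hij : i + 1 = j := hij
    by_cases h : i + k ≤ 0
    · simp [hx h]
    · congr 1
      lia

/-- The endomorphism of the direct sum of the stupid truncations whose cokernel is the complex. -/
noncomputable def brutalTelescope : K.brutalSum ⟶ K.brutalSum where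
  -- The composite of identities is kept so that `telescope_exact` applies with `i` and `r` both the
  -- identity.
  f i := ModuleCat.ofHom (telescope (LinearMap.id ∘ₗ LinearMap.id))
  comm' i j _ := by
    refine ModuleCat.hom_ext (Finsupp.lhom_ext fun l x ↦ ?_)
    change finsuppSucc (K.d i j).hom (telescope _ (Finsupp.single l x)) =
      telescope _ (finsuppSucc (K.d i j).hom (Finsupp.single l x))
    simp

/-- The projection from the direct sum of the stupid truncations to the complex. -/
noncomputable def brutalToSelf : K.brutalSum ⟶ K where
  f i := ModuleCat.ofHom (telescopeSum LinearMap.id)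
  comm' i j _ := by
    refine ModuleCat.hom_ext (Finsupp.lhom_ext fun l x ↦ ?_)
    change (K.d i j).hom (telescopeSum LinearMap.id (Finsupp.single l x)) =
      telescopeSum LinearMap.id (finsuppSucc (K.d i j).hom (Finsupp.single l x))
    simp

/-- A complex as the sequential colimit of its stupid truncations. -/
noncomputable def brutalShortComplex : ShortComplex (CochainComplex (ModuleCat.{u} S) ℤ) :=
  ShortComplex.mk K.brutalTelescope K.brutalToSelf (by
    ext i : 1
    exact ModuleCat.hom_ext (LinearMap.ext
      (telescope_exact (LinearMap.id_comp LinearMap.id)).apply_apply_eq_zero))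

lemma brutalShortComplex_shortExact : K.brutalShortComplex.ShortExact :=
  HomologicalComplex.shortExact_of_degreewise_shortExact _ fun _ ↦
    ModuleCat.shortExact_of_exact _ (telescope_injective _)
      (telescope_exact (LinearMap.id_comp LinearMap.id))
      (telescopeSum_surjective (LinearMap.id_comp LinearMap.id))

instance [K.IsStrictlyLE 0] (k : ℕ) : (K.brutal k).IsStrictlyLE 0 := by
  rw [isStrictlyLE_iff]
  intro i hi
  have := ModuleCat.subsingleton_of_isZero (K.isZero_of_isStrictlyLE 0 i hi)
  exact ModuleCat.isZero_of_subsingleton (ModuleCat.of S (brutalSubmodule K k i))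

instance [∀ i, Projective (K.X i)] (k : ℕ) (i : ℤ) : Projective ((K.brutal k).X i) := by
  by_cases h : i + k ≤ 0
  · have : Subsingleton (brutalSubmodule K k i) :=
      ⟨fun x y ↦ Subtype.ext ((x.2 h).trans (y.2 h).symm)⟩
    exact Projective.of_iso ((isZero_zero (ModuleCat.{u} S)).iso
      (ModuleCat.isZero_of_subsingleton (ModuleCat.of S (brutalSubmodule K k i)))) inferInstance
  · have : brutalSubmodule K k i = ⊤ := by
      ext x
      simp [mem_brutalSubmodule_iff, h]
    exact Projective.of_iso (LinearEquiv.ofTop _ this).toModuleIso.symm inferInstance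

lemma nonempty_isColimit_brutalι [K.IsStrictlyLE 0] :
    Nonempty (IsColimit (Cofan.mk K.brutalSum (fun k : ULift.{u} ℕ ↦ K.brutalι k.down))) := by
  refine ⟨HomologicalComplex.isColimitOfEval _ _ (fun i ↦
    (isColimitMapCoconeCofanMkEquiv _ _ _).2 ?_)⟩
  -- The value `k = l + 1 - i` inverts `l = k + i - 1`. The cutoffs by `toNat` matter only when `i >
  -- 0` or `i + k ≤ 0`, where the terms are zero.
  have hmem (l : ℕ) (x : K.X i) : x ∈ brutalSubmodule K (l + 1 - i).toNat i := fun h ↦ by lia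
  refine Cofan.IsColimit.mk _ (fun s ↦ ModuleCat.ofHom (Finsupp.lsum ℕ (fun l ↦
    (s.inj ⟨(l + 1 - i).toNat⟩).hom.comp
      (LinearMap.codRestrict _ LinearMap.id (hmem l))))) ?_ ?_
  · intro s ⟨k⟩
    refine ModuleCat.hom_ext (LinearMap.ext fun ⟨x, hx⟩ ↦ ?_)
    refine (Finsupp.lsum_single ℕ _ _ x).trans ?_
    have key (k' : ℕ) (hx' : x ∈ brutalSubmodule K k' i) (hk : k' = k) :
        (s.inj ⟨k'⟩).hom ⟨x, hx'⟩ = (s.inj ⟨k⟩).hom ⟨x, hx⟩ := by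
      subst hk
      rfl
    by_cases h : i + k ≤ 0
    · obtain rfl : x = 0 := hx h
      exact (map_zero _).trans (map_zero (s.inj ⟨k⟩).hom).symm
    · exact key _ _ (by lia)
  · intro s m hm
    refine ModuleCat.hom_ext (Finsupp.lhom_ext fun l x ↦ ?_)
    refine Eq.trans ?_ (Finsupp.lsum_single ℕ _ _ x).symm
    refine Eq.trans ?_ congr(ModuleCat.Hom.hom $(hm ⟨(l + 1 - i).toNat⟩) ⟨x, hmem l x⟩)
    change m.hom _ = m.hom (Finsupp.single _ x)
    by_cases h : 0 < i
    · have := ModuleCat.subsingleton_of_isZero (K.isZero_of_isStrictlyLE 0 i h)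
      simp [Subsingleton.elim x 0]
    · congr 2
      lia

/-- The projection from a stupid truncation to its lowest term. -/
noncomputable def brutalToSingle (k : ℕ) :
    K.brutal (k + 1) ⟶ (HomologicalComplex.single _ _ (-k : ℤ)).obj (K.X (-k)) :=
  HomologicalComplex.mkHomToSingle (ModuleCat.ofHom (brutalSubmodule K (k + 1) (-k)).subtype)
    (fun i hi ↦ by
      refine ModuleCat.hom_ext (LinearMap.ext fun ⟨x, hx⟩ ↦ ?_)
      obtain rfl : x = 0 := hx (by have : i + 1 = -k := hi; lia)
      exact map_zero _)

lemma brutalToSingle_f (k : ℕ) : (K.brutalToSingle k).f (-k) =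
    ModuleCat.ofHom (brutalSubmodule K (k + 1) (-k)).subtype ≫
      (HomologicalComplex.singleObjXSelf _ _ _).inv :=
  HomologicalComplex.mkHomToSingle_f _ _

lemma brutalToSingle_f_eq_zero_iff (k : ℕ) (x : brutalSubmodule K (k + 1) (-k)) :
    ((K.brutalToSingle k).f (-k)).hom x = 0 ↔ x.1 = 0 := by
  rw [brutalToSingle_f]
  exact map_eq_zero_iff _ ((ModuleCat.mono_iff_injective
    (HomologicalComplex.singleObjXSelf (.up ℤ) (-k : ℤ) (K.X (-k))).inv).1 inferInstance)

lemma brutalToSingle_f_surjective (k : ℕ) :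
    Function.Surjective ((K.brutalToSingle k).f (-k)).hom := by
  rw [brutalToSingle_f]
  have h : Function.Surjective (brutalSubmodule K (k + 1) (-k)).subtype :=
    fun x ↦ ⟨⟨x, fun h ↦ by lia⟩, rfl⟩
  exact ((ModuleCat.epi_iff_surjective
    (HomologicalComplex.singleObjXSelf (.up ℤ) (-k : ℤ) (K.X (-k))).inv).1 inferInstance).comp h

/-- The stupid truncations in degrees `> -k` and `> -(k + 1)` differ by one term. -/
noncomputable def brutalSuccShortComplex (k : ℕ) :
    ShortComplex (CochainComplex (ModuleCat.{u} S) ℤ) :=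
  ShortComplex.mk (K.brutalSucc k) (K.brutalToSingle k) (by
    refine HomologicalComplex.to_single_hom_ext (ModuleCat.hom_ext (LinearMap.ext fun ⟨x, hx⟩ ↦ ?_))
    obtain rfl : x = 0 := hx (by simp)
    exact map_zero _)

lemma brutalSuccShortComplex_shortExact (k : ℕ) : (K.brutalSuccShortComplex k).ShortExact := by
  refine HomologicalComplex.shortExact_of_degreewise_shortExact _ fun i ↦
    ModuleCat.shortExact_of_exact _ ?_ ?_ ?_
  · intro x y hxy
    exact Subtype.ext congr(Subtype.val $hxy)
  · intro ⟨x, hx⟩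
    by_cases h : i = -k
    · subst h
      refine (brutalToSingle_f_eq_zero_iff K k ⟨x, hx⟩).trans ⟨fun hx ↦ ?_, ?_⟩
      · obtain rfl : x = 0 := hx
        exact ⟨0, map_zero _⟩
      · rintro ⟨⟨y, hy⟩, hyx⟩
        obtain rfl : y = 0 := hy (by simp)
        exact congr(Subtype.val $hyx).symm
    · have := ModuleCat.subsingleton_of_isZero
        (HomologicalComplex.isZero_single_obj_X (.up ℤ) (-k) (K.X (-k)) i h)
      exact iff_of_true (this.elim _ _) ⟨⟨x, fun hi ↦ hx (by lia)⟩, rfl⟩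
  · by_cases h : i = -k
    · subst h
      exact brutalToSingle_f_surjective K k
    · have := ModuleCat.subsingleton_of_isZero
        (HomologicalComplex.isZero_single_obj_X (.up ℤ) (-k) (K.X (-k)) i h)
      exact fun y ↦ ⟨0, this.elim _ _⟩

end CochainComplex

namespace IsSuspendedWithSums

open CochainComplex DerivedCategory

variable {S : Type u} [Ring S] [HasDerivedCategory.{w} (ModuleCat.{u} S)]
  {P : ObjectProperty (DerivedCategory (ModuleCat.{u} S))} (hP : IsSuspendedWithSums.{u} P)

include hP

/-- A stupid truncation is a finite iterated extension of its terms, each placed in a nonpositive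
degree. -/
lemma Q_obj_brutal (K : CochainComplex (ModuleCat.{u} S) ℤ) [K.IsStrictlyLE 0]
    (hK : ∀ i, P ((DerivedCategory.singleFunctor _ 0).obj (K.X i))) (k : ℕ) :
    P (Q.obj (K.brutal k)) := by
  induction k with
  | zero =>
    refine hP.of_isZero (Functor.map_isZero _ ?_)
    rw [IsZero.iff_id_eq_zero]
    ext i : 1
    refine ModuleCat.hom_ext (LinearMap.ext fun ⟨x, hx⟩ ↦ Subtype.ext ?_)
    by_cases h : 0 < i
    · have := ModuleCat.subsingleton_of_isZero (K.isZero_of_isStrictlyLE 0 i h)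
      exact Subsingleton.elim _ _
    · exact hx (by simpa using h)
  | succ k hk =>
    exact hP.ext _ (triangleOfSES_distinguished (K.brutalSuccShortComplex_shortExact k)) hk
      (hP.single_neg (hK _) k)

/-- A suspended subcategory with direct sums which contains the free module of rank one contains
the standard aisle. -/
lemma of_isLE (hS : P ((DerivedCategory.singleFunctor _ 0).obj (ModuleCat.of S S)))
    (X : DerivedCategory (ModuleCat.{u} S)) [X.IsLE 0] : P X := by
  obtain ⟨K, _, ⟨e⟩⟩ := X.exists_iso_Q_obj_of_isLE 0
  obtain ⟨L, f, hf, hL, _⟩ := exists_quasiIso_projective K 0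
  have (k : ULift.{u} ℕ) : (L.brutal k.down).IsKProjective := isKProjective_of_projective _ 0
  have h : P (Q.obj L.brutalSum) :=
    hP.sum _ _ _ (nonempty_isColimit_Q_cofan L.nonempty_isColimit_brutalι.some)
      (fun k ↦ hP.Q_obj_brutal L (fun i ↦ hP.single_of_projective hS _) k.down)
  exact hP.of_iso (asIso (Q.map f) ≪≫ e.symm)
    (hP.ext₃ (triangleOfSES_distinguished L.brutalShortComplex_shortExact) h h)

end IsSuspendedWithSums

/-! ### Calculus of vanishing Homs along shifts and triangles. -/

section Vanishing

variable {C : Type u} [Category.{v} C] [Preadditive C] [HasShift C ℤ]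

/-- All the morphisms `G ⟶ X⟦j⟧` vanish. -/
def HomVanishes (G X : C) (j : ℤ) : Prop :=
  ∀ f : G ⟶ X⟦j⟧, f = 0

namespace HomVanishes

variable {G G' X X' : C} {i j k : ℤ}

lemma of_iso (h : HomVanishes G X j) (e : X ≅ X') : HomVanishes G X' j := fun f ↦ by
  rw [← cancel_mono ((shiftFunctor C j).mapIso e.symm).hom, zero_comp]
  exact h _

lemma of_iso_left (h : HomVanishes G X j) (e : G ≅ G') : HomVanishes G' X j := fun f ↦ by
  rw [← cancel_epi e.hom, comp_zero]
  exact h _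

lemma of_isZero_left (hG : IsZero G) : HomVanishes G X j := fun _ ↦ hG.eq_of_src _ _

lemma shift_iff (h : i + j = k) : HomVanishes G (X⟦i⟧) j ↔ HomVanishes G X k := by
  let e : (X⟦i⟧)⟦j⟧ ≅ X⟦k⟧ := ((shiftFunctorAdd' C i j k h).app X).symm
  constructor
  · intro h f
    rw [← cancel_mono e.inv, zero_comp]
    exact h _
  · intro h f
    rw [← cancel_mono e.hom, zero_comp]
    exact h _

lemma zero_iff : HomVanishes G X 0 ↔ ∀ f : G ⟶ X, f = 0 := by
  let e : X⟦(0 : ℤ)⟧ ≅ X := (shiftFunctorZero C ℤ).app X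
  constructor
  · intro h f
    rw [← cancel_mono e.inv, zero_comp]
    exact h _
  · intro h f
    rw [← cancel_mono e.hom, zero_comp]
    exact h _

variable [∀ n : ℤ, (shiftFunctor C n).Additive]

lemma of_isZero (hX : IsZero X) : HomVanishes G X j := fun _ ↦
  ((shiftFunctor C j).map_isZero hX).eq_of_tgt _ _

lemma shift_left_iff (h : i + j = k) : HomVanishes (G⟦i⟧) X k ↔ HomVanishes G X j := by
  let e : (X⟦j⟧)⟦i⟧ ≅ X⟦k⟧ := ((shiftFunctorAdd' C j i k (by lia)).app X).symm
  constructor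
  · intro h f
    apply (shiftFunctor C i).map_injective
    rw [← cancel_mono e.hom, Functor.map_zero, zero_comp]
    exact h _
  · intro h f
    obtain ⟨g, hg⟩ := (shiftFunctor C i).map_surjective (f ≫ e.inv)
    rw [← cancel_mono e.inv, ← hg, h g, Functor.map_zero, zero_comp]

variable [HasZeroObject C] [Pretriangulated C] {T : Triangle C} (hT : T ∈ distTriang C)

include hT

lemma obj₂ (h₁ : HomVanishes G T.obj₁ j) (h₃ : HomVanishes G T.obj₃ j) :
    HomVanishes G T.obj₂ j := fun f ↦ by
  obtain ⟨g, hg⟩ := Triangle.coyoneda_exact₂ _ (Triangle.shift_distinguished _ hT j) f (h₃ _)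
  obtain rfl : g = 0 := h₁ g
  exact hg.trans zero_comp

lemma obj₃ (h₂ : HomVanishes G T.obj₂ j) (h₁ : HomVanishes G T.obj₁ (j + 1)) :
    HomVanishes G T.obj₃ j :=
  obj₂ (rot_of_distTriang _ hT) h₂ ((shift_iff (by lia)).2 h₁)

lemma obj₁ (h₃ : HomVanishes G T.obj₃ (j - 1)) (h₂ : HomVanishes G T.obj₂ j) :
    HomVanishes G T.obj₁ j :=
  obj₂ (inv_rot_of_distTriang _ hT) ((shift_iff (by lia)).2 h₃) h₂

lemma left_obj₂ (h₁ : HomVanishes T.obj₁ X j) (h₃ : HomVanishes T.obj₃ X j) :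
    HomVanishes T.obj₂ X j := fun f ↦ by
  obtain ⟨g, hg⟩ := Triangle.yoneda_exact₂ _ hT f (h₁ _)
  rw [hg, h₃ g, comp_zero]

lemma left_obj₁ (h₂ : HomVanishes T.obj₂ X j) (h₃ : HomVanishes T.obj₃ X (j + 1)) :
    HomVanishes T.obj₁ X j :=
  left_obj₂ (inv_rot_of_distTriang _ hT) ((shift_left_iff (by lia)).2 h₃) h₂

lemma left_obj₃ (h₂ : HomVanishes T.obj₂ X j) (h₁ : HomVanishes T.obj₁ X (j - 1)) :
    HomVanishes T.obj₃ X j :=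
  left_obj₂ (rot_of_distTriang _ hT) h₂ ((shift_left_iff (by lia)).2 h₁)

end HomVanishes

end Vanishing

namespace IsSuspendedWithSums

variable {C : Type u} [Category.{v} C] [Preadditive C] [HasZeroObject C] [HasShift C ℤ]
  [∀ n : ℤ, (shiftFunctor C n).Additive] [Pretriangulated C]

lemma comap_shift {P : ObjectProperty C} (hP : IsSuspendedWithSums.{t} P) (n : ℤ) :
    IsSuspendedWithSums.{t} (fun X ↦ P (X⟦n⟧)) where
  ext Z hZ h₁ h₃ := hP.ext _ (Triangle.shift_distinguished _ hZ n) h₁ h₃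
  shift X j hj h := hP.of_iso (shiftComm X n j) (hP.shift _ j hj h)
  sum J F c := fun ⟨hc⟩ h ↦ hP.sum J _ _ ⟨(isColimitMapCoconeCofanMkEquiv (shiftFunctor C n) _ _)
    (isColimitOfPreserves (shiftFunctor C n) (hc.ofIsoColimit
      (Cofan.ext (c₂ := Cofan.mk c.pt c.inj) (Iso.refl _))))⟩ h

/-- This closure lets an orthogonality be tested on the generator of `Susp` alone. A positive shift
of `X` lowers the degree of the Homs, hence the whole range `j ≤ 0`. -/
lemma homVanishes (Y : C) :
    IsSuspendedWithSums.{t} (fun X ↦ ∀ j ≤ 0, HomVanishes X Y j) where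
  ext Z hZ h₁ h₃ j hj := .left_obj₂ hZ (h₁ j hj) (h₃ j hj)
  shift X j hj h k hk := (HomVanishes.shift_left_iff (add_sub_cancel j k)).2 (h _ (by lia))
  sum J F c := fun ⟨hc⟩ h j hj f ↦ Cofan.IsColimit.hom_ext hc _ _ fun a ↦
    (h a j hj _).trans (h a j hj _).symm

end IsSuspendedWithSums

lemma Susp.homVanishes {C : Type u} [Category.{v} C] [Preadditive C] [HasZeroObject C]
    [HasShift C ℤ] [∀ n : ℤ, (shiftFunctor C n).Additive] [Pretriangulated C] {E X Y : C}
    (hX : Susp.{t} E X) (hY : ∀ j ≤ 0, HomVanishes E Y j) : ∀ j ≤ 0, HomVanishes X Y j :=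
  hX _ (IsSuspendedWithSums.homVanishes Y) hY

lemma CategoryTheory.Triangulated.TStructure.homVanishes {C : Type u} [Category.{v} C]
    [Preadditive C] [HasZeroObject C] [HasShift C ℤ] [∀ n : ℤ, (shiftFunctor C n).Additive]
    [Pretriangulated C] (t : TStructure C) (X Y : C) (a b j : ℤ) [t.IsLE X a] [t.IsGE Y b]
    (h : a + j < b) : HomVanishes X Y j := fun f ↦ by
  have := t.isGE_shift Y b j (b - j)
  exact t.zero f a (b - j)

/-! ### From approximation triangles to t-structures. -/

section Approximations

variable {C : Type u} [Category.{v} C] [Preadditive C] [HasZeroObject C] [HasShift C ℤ]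
  [∀ n : ℤ, (shiftFunctor C n).Additive] [Pretriangulated C]

/-- There is a morphism `X ⟶ Y` whose fibre satisfies `P`. -/
def HasMorphismWithFibre (P : ObjectProperty C) (X Y : C) : Prop :=
  ∃ (B : C) (f : B ⟶ X) (g : X ⟶ Y) (h : Y ⟶ B⟦(1 : ℤ)⟧), Triangle.mk f g h ∈ distTriang C ∧ P B

/-- By the octahedral axiom, the fibre of a composite is an extension of the two fibres. -/
lemma HasMorphismWithFibre.trans [IsTriangulated C] {P : ObjectProperty C} {X Y Z : C}
    (hP : ∀ T : Triangle C, T ∈ distTriang C → P T.obj₁ → P T.obj₃ → P T.obj₂)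
    (h : HasMorphismWithFibre P X Y) (h' : HasMorphismWithFibre P Y Z) :
    HasMorphismWithFibre P X Z := by
  obtain ⟨B, f, g, _, hT, hB⟩ := h
  obtain ⟨B', f', g', _, hT', hB'⟩ := h'
  obtain ⟨B'', f'', g'', hT''⟩ := distinguished_cocone_triangle₁ (g ≫ g')
  exact ⟨B'', f'', g ≫ g', g'', hT'',
    hP _ (Triangulated.someOctahedron' rfl hT hT' hT'').mem hB hB'⟩

lemma HasMorphismWithFibre.shift {P P' : ObjectProperty C} {X X' Y : C} (h : HasMorphismWithFibre P X Y)
    (k : ℤ) (hP : ∀ B, P B → P' (B⟦k⟧)) (e : X⟦k⟧ ≅ X') : HasMorphismWithFibre P' X' (Y⟦k⟧) := by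
  obtain ⟨B, f, g, h, hT, hB⟩ := h
  exact ⟨_, _, _, _, distinguished_of_iso₂ (Triangle.shift_distinguished _ hT k) e, hP _ hB⟩

/-- A class of objects which is closed under negative shifts and has approximations is a
co-aisle. -/
lemma exists_tStructure_of_hasMorphismWithFibre (V : ObjectProperty C)
    [V.IsClosedUnderIsomorphisms] (hV : ∀ X, V X → V (X⟦(-1 : ℤ)⟧))
    (h : ∀ X, ∃ Y, V Y ∧ HasMorphismWithFibre (fun U ↦ ∀ W, V W → ∀ f : U ⟶ W, f = 0) X Y) :
    ∃ t : TStructure C, t.ge 0 = V := by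
  have e (X : C) : X⟦(0 : ℤ)⟧ ≅ X := (shiftFunctorZero C ℤ).app X
  let L : ObjectProperty C := fun U ↦ ∀ W, V W → ∀ f : U ⟶ W, f = 0
  have : L.IsClosedUnderIsomorphisms := ⟨fun {X X'} e hX W hW f ↦ by
    rw [← cancel_epi e.hom, comp_zero]
    exact hX W hW _⟩
  have hL (X : C) (hX : L X) : L (X⟦(1 : ℤ)⟧) := fun W hW f ↦ by
    have := (HomVanishes.shift_iff (G := X) (X := W) (i := -1) (j := 0) (k := -1) (by simp)).1
      (HomVanishes.zero_iff.2 (hX _ (hV _ hW)))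
    exact HomVanishes.zero_iff.1
      ((HomVanishes.shift_left_iff (i := 1) (j := -1) (k := 0) (by simp)).2 this) f
  let add (X : C) (a b c : ℤ) (h : a + b = c) : (X⟦a⟧)⟦b⟧ ≅ X⟦c⟧ :=
    ((shiftFunctorAdd' C a b c h).app X).symm
  let t : TStructure C :=
    -- The left orthogonal of the co-aisle `ge 0` is `le (-1)`, hence the extra shift by one. For
    -- the same reason the approximation is taken below at `X⟦1⟧` and shifted back.
    { le n X := L (X⟦n + 1⟧)
      ge n X := V (X⟦n⟧)
      le_isClosedUnderIsomorphisms n :=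
        ⟨fun {X X'} e hX ↦ L.prop_of_iso ((shiftFunctor C (n + 1)).mapIso e) hX⟩
      ge_isClosedUnderIsomorphisms n :=
        ⟨fun {X X'} e hX ↦ V.prop_of_iso ((shiftFunctor C n).mapIso e) hX⟩
      le_shift n a n' h X hX := L.prop_of_iso (add X a (n' + 1) (n + 1) (by lia)).symm hX
      ge_shift n a n' h X hX := V.prop_of_iso (add X a n' n h).symm hX
      zero' X Y f hX hY := by
        apply (shiftFunctor C (1 : ℤ)).map_injective
        rw [Functor.map_zero]
        exact hX _ hY _
      le_zero_le X hX := L.prop_of_iso (add X (0 + 1) 1 (1 + 1) (by simp)) (hL _ hX)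
      ge_one_le X hX := V.prop_of_iso (add X 1 (-1) 0 (by simp)) (hV _ hX)
      exists_triangle_zero_one X := by
        obtain ⟨Y, hY, h⟩ := h (X⟦(1 : ℤ)⟧)
        obtain ⟨U, f, g, h, hT, hU⟩ := h.shift (-1) (P' := fun X ↦ L (X⟦(0 + 1 : ℤ)⟧))
          (fun B hB ↦ L.prop_of_iso ((add B (-1) (0 + 1) 0 (by simp)) ≪≫ e B).symm hB)
          (add X 1 (-1) 0 (by simp) ≪≫ e X)
        exact ⟨U, _, hU, V.prop_of_iso ((add Y (-1) 1 0 (by simp)) ≪≫ e Y).symm hY, f, g, h, hT⟩ }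
  refine ⟨t, ?_⟩
  ext X
  exact V.prop_iff_of_iso (e X)

end Approximations

/-! ### Homs from projectives and from the regular module. -/

section DerivedVanishing

open CochainComplex DerivedCategory

variable {A : Type u} [Category.{v} A] [Abelian A]

instance (P : A) [Projective P] : ((CochainComplex.singleFunctor A 0).obj P).IsKProjective := by
  have (i : ℤ) : Projective (((CochainComplex.singleFunctor A 0).obj P).X i) := by
    by_cases hi : i = 0
    · subst hi
      exact Projective.of_iso (HomologicalComplex.singleObjXSelf (.up ℤ) 0 P).symm inferInstance
    · exact Projective.of_iso ((isZero_zero A).iso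
        (HomologicalComplex.isZero_single_obj_X (.up ℤ) 0 P i hi)) inferInstance
  exact isKProjective_of_projective _ 0

variable [HasDerivedCategory.{w} A]

lemma homVanishes_singleFunctor_iff [HasExt.{t} A] (M N : A) (i : ℕ) :
    HomVanishes ((DerivedCategory.singleFunctor _ 0).obj M)
      ((DerivedCategory.singleFunctor _ 0).obj N) i ↔ Subsingleton (Abelian.Ext M N i) := by
  rw [Abelian.Ext.homEquiv.subsingleton_congr]
  exact ⟨fun h ↦ ⟨fun f g ↦ (h f).trans (h g).symm⟩, fun h f ↦ h.elim _ _⟩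

/-- A projective in degree 0 is K-projective, and `X⟦j⟧` is represented by a complex in negative
degrees, so already the chain maps vanish. -/
lemma homVanishes_of_projective (P : A) [Projective P] (X : DerivedCategory A) (m j : ℤ)
    [X.IsLE m] (h : m < j) : HomVanishes ((DerivedCategory.singleFunctor _ 0).obj P) X j := by
  intro f
  have := TStructure.t.isLE_shift X m j (m - j)
  obtain ⟨K, _, ⟨e⟩⟩ := (X⟦j⟧).exists_iso_Q_obj_of_isLE (m - j)
  obtain ⟨φ, hφ⟩ := exists_Q_map_eq ((CochainComplex.singleFunctor A 0).obj P) K (f ≫ e.hom)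
  have h0 : φ = 0 := by
    ext i
    by_cases hi : i = 0
    · exact (K.isZero_of_isStrictlyLE (m - j) i (by lia)).eq_of_tgt _ _
    · exact (HomologicalComplex.isZero_single_obj_X (.up ℤ) 0 P i hi).eq_of_src _ _
  rw [← cancel_mono e.hom, zero_comp]
  exact hφ.symm.trans ((congrArg _ h0).trans (Q.map_zero _ _))

end DerivedVanishing

section ModuleVanishing

open CochainComplex DerivedCategory HomComplex

variable {S : Type u} [Ring S] [HasDerivedCategory.{w} (ModuleCat.{u} S)]

/-- A cycle `x` of degree `j` is the same as a chain map from `S` to the `j`-th shift, and a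
null-homotopy of that map evaluated at 1 is an element with boundary `x`. -/
lemma isZero_homology_of_homVanishes {X : DerivedCategory (ModuleCat.{u} S)} {j : ℤ}
    (h : HomVanishes ((DerivedCategory.singleFunctor _ 0).obj (ModuleCat.of S S)) X j) :
    IsZero ((homologyFunctor _ j).obj X) := by
  let K := Q.objPreimage X
  let e : Q.obj K ≅ X := Q.objObjPreimageIso X
  have h' := h.of_iso e.symm
  have : Projective (ModuleCat.of S S) := (IsProjective.iff_projective _).1 inferInstance
  have h₁ := mem_coboundaries_of_forall_eq_zero
    (P := (CochainComplex.singleFunctor _ 0).obj (ModuleCat.of S S)) (K := K) h'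
  have hK : K.ExactAt j := by
    rw [HomologicalComplex.exactAt_iff' _ (j - 1) j (j + 1) (by simp) (by simp),
      ShortComplex.moduleCat_exact_iff]
    intro x hx
    have := (Cocycle.fromSingleMk_mem_coboundaries_iff
      (ModuleCat.ofHom (LinearMap.toSpanSingleton S (K.X j) x)) (zero_add j) (j + 1) rfl (by
        refine ModuleCat.hom_ext (LinearMap.ext_ring ?_)
        change (K.d j (j + 1)).hom ((1 : S) • x) = 0
        rw [one_smul]
        exact hx) (j - 1) (by simp)).1 (h₁ _)
    obtain ⟨g, hg⟩ := this
    refine ⟨g.hom (1 : S), ?_⟩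
    exact (congr(ModuleCat.Hom.hom $hg (1 : S))).trans (one_smul S x)
  exact (hK.isZero_homology).of_iso ((homologyFunctor _ j).mapIso e.symm ≪≫
    (homologyFunctorFactors _ j).app K)

lemma isGE_iff_homVanishes (X : DerivedCategory (ModuleCat.{u} S)) (i : ℤ) :
    X.IsGE i ↔ ∀ j < i, HomVanishes ((DerivedCategory.singleFunctor _ 0).obj (ModuleCat.of S S)) X j :=
  ⟨fun _ j hj ↦ TStructure.t.homVanishes _ _ 0 i _ (by simpa),
    fun h ↦ (isGE_iff X i).2 fun j hj ↦ isZero_homology_of_homVanishes (h j hj)⟩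

lemma isLE_of_homVanishes {X : DerivedCategory (ModuleCat.{u} S)} {i : ℤ}
    (h : ∀ j > i, HomVanishes ((DerivedCategory.singleFunctor _ 0).obj (ModuleCat.of S S)) X j) :
    X.IsLE i :=
  (isLE_iff X i).2 fun j hj ↦ isZero_homology_of_homVanishes (h j hj)

end ModuleVanishing

/-! ### Splitting long exact sequences into short ones. -/

section Syzygies

variable {S : Type u} [Ring S]

lemma LinearMap.exact_range_subtype {M N Q : Type*} [AddCommGroup M] [AddCommGroup N]
    [AddCommGroup Q] [Module S M] [Module S N] [Module S Q] {f : M →ₗ[S] N} {g : N →ₗ[S] Q}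
    (h : Function.Exact f g) : Function.Exact (LinearMap.range f).subtype g := fun y ↦
  (h y).trans (by simp)

lemma LinearMap.exact_rangeRestrict {M N Q : Type*} [AddCommGroup M] [AddCommGroup N]
    [AddCommGroup Q] [Module S M] [Module S N] [Module S Q] {f : M →ₗ[S] N} {g : N →ₗ[S] Q}
    (h : Function.Exact f g) : Function.Exact f g.rangeRestrict := fun y ↦
  Subtype.ext_iff.trans (h y)

/-- The syzygies of an exact sequence `⋯ ⟶ P 1 ⟶ P 0 ⟶ T ⟶ 0`. -/
lemma exists_syzygies {T : ModuleCat.{u} S} {P : ℕ → ModuleCat.{u} S} (d : ∀ i, P (i + 1) ⟶ P i)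
    (ε : P 0 ⟶ T) (hε : Function.Surjective ε) (h₀ : Function.Exact (d 0) ε)
    (h : ∀ i, Function.Exact (d (i + 1)) (d i)) :
    ∃ Ω : ℕ → ModuleCat.{u} S, Nonempty (Ω 0 ≅ T) ∧ (∀ i, IsZero (P i) → IsZero (Ω i)) ∧
      ∀ i, ∃ (f : Ω (i + 1) ⟶ P i) (g : P i ⟶ Ω i) (w : f ≫ g = 0),
        (ShortComplex.mk f g w).ShortExact := by
  let Ω : ℕ → ModuleCat.{u} S
    | 0 => T
    | i + 1 => ModuleCat.of S (LinearMap.range (d i).hom)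
  let f (i : ℕ) : Ω (i + 1) ⟶ P i := ModuleCat.ofHom (LinearMap.range (d i).hom).subtype
  have hf (i : ℕ) : Function.Injective (f i).hom := Subtype.val_injective
  refine ⟨Ω, ⟨Iso.refl _⟩, ?_, ?_⟩
  · rintro (_ | i) hi
    · have := ModuleCat.subsingleton_of_isZero hi
      have := hε.subsingleton
      exact ModuleCat.isZero_of_subsingleton T
    · have := ModuleCat.subsingleton_of_isZero hi
      have := (d i).hom.surjective_rangeRestrict.subsingleton
      exact ModuleCat.isZero_of_subsingleton (ModuleCat.of S (LinearMap.range (d i).hom))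
  · rintro (_ | i)
    · have h := LinearMap.exact_range_subtype h₀
      exact ⟨f 0, ε, ModuleCat.hom_ext (LinearMap.ext h.apply_apply_eq_zero),
        ModuleCat.shortExact_of_exact _ (hf 0) h hε⟩
    · have h := LinearMap.exact_rangeRestrict (LinearMap.exact_range_subtype (h i))
      exact ⟨f (i + 1), ModuleCat.ofHom (d i).hom.rangeRestrict,
        ModuleCat.hom_ext (LinearMap.ext h.apply_apply_eq_zero),
        ModuleCat.shortExact_of_exact _ (hf _) h (LinearMap.surjective_rangeRestrict _)⟩

/-- The cosyzygies of an exact sequence `0 ⟶ N ⟶ Q 0 ⟶ Q 1 ⟶ ⋯`. -/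
lemma exists_cosyzygies {N : ModuleCat.{u} S} {Q : ℕ → ModuleCat.{u} S}
    (d : ∀ i, Q i ⟶ Q (i + 1)) (η : N ⟶ Q 0) (hη : Function.Injective η)
    (h₀ : Function.Exact η (d 0)) (h : ∀ i, Function.Exact (d i) (d (i + 1))) :
    ∃ Z : ℕ → ModuleCat.{u} S, Nonempty (Z 0 ≅ N) ∧ (∀ i, IsZero (Q i) → IsZero (Z i)) ∧
      ∀ i, ∃ (f : Z i ⟶ Q i) (g : Q i ⟶ Z (i + 1)) (w : f ≫ g = 0),
        (ShortComplex.mk f g w).ShortExact := by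
  let Z : ℕ → ModuleCat.{u} S
    | 0 => N
    | i + 1 => ModuleCat.of S (LinearMap.range (d i).hom)
  let g (i : ℕ) : Q i ⟶ Z (i + 1) := ModuleCat.ofHom (d i).hom.rangeRestrict
  have hg (i : ℕ) : Function.Surjective (g i).hom := LinearMap.surjective_rangeRestrict _
  refine ⟨Z, ⟨Iso.refl _⟩, ?_, ?_⟩
  · rintro (_ | i) hi
    · have := ModuleCat.subsingleton_of_isZero hi
      have := hη.subsingleton
      exact ModuleCat.isZero_of_subsingleton N
    · have := ModuleCat.subsingleton_of_isZero hi
      exact ModuleCat.isZero_of_subsingleton (ModuleCat.of S (LinearMap.range (d i).hom))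
  · rintro (_ | i)
    · have h := LinearMap.exact_rangeRestrict (f := η.hom) h₀
      exact ⟨η, g 0, ModuleCat.hom_ext (LinearMap.ext h.apply_apply_eq_zero),
        ModuleCat.shortExact_of_exact _ hη h (hg 0)⟩
    · have h := LinearMap.exact_rangeRestrict (LinearMap.exact_range_subtype (h i))
      exact ⟨ModuleCat.ofHom (LinearMap.range (d i).hom).subtype, g (i + 1),
        ModuleCat.hom_ext (LinearMap.ext h.apply_apply_eq_zero),
        ModuleCat.shortExact_of_exact _ Subtype.val_injective h (hg _)⟩

end Syzygies

/-! ### Homs from T and the class `suspVanishing`. -/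

section TiltingVanishing

open CochainComplex DerivedCategory

variable {R : Type u} [Ring R] [HasDerivedCategory.{w} (ModuleCat.{u} Rᵐᵒᵖ)]

/-- A module, viewed as an object of the derived category concentrated in degree `0`. -/
noncomputable abbrev derivedSingle (M : ModuleCat.{u} Rᵐᵒᵖ) : DerivedCategory (ModuleCat.{u} Rᵐᵒᵖ) :=
  (DerivedCategory.singleFunctor _ 0).obj M

/-- The free right module of rank one, as a left module over the opposite ring. -/
def oppositeRegularIso : ModuleCat.of Rᵐᵒᵖ R ≅ ModuleCat.of Rᵐᵒᵖ Rᵐᵒᵖ :=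
  LinearEquiv.toModuleIso
    { MulOpposite.opAddEquiv with
      map_smul' := fun _ _ ↦ rfl }

variable {T : ModuleCat.{u} Rᵐᵒᵖ}

lemma homVanishes_left_copies {X : DerivedCategory (ModuleCat.{u} Rᵐᵒᵖ)} {j : ℤ}
    (h : HomVanishes (derivedSingle T) X j) (α : Type u) :
    HomVanishes (derivedSingle (copies T α)) X j := fun f ↦ by
  obtain ⟨hc⟩ := nonempty_isColimit_singleFunctor_finsupp T α
  refine Cofan.IsColimit.hom_ext hc _ _ (fun a ↦ ?_)
  exact (h _).trans (h _).symm

lemma homVanishes_left_of_isSummandOfCopies {X : DerivedCategory (ModuleCat.{u} Rᵐᵒᵖ)} {j : ℤ}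
    (h : HomVanishes (derivedSingle T) X j) {M : ModuleCat.{u} Rᵐᵒᵖ} (hM : IsSummandOfCopies T M) :
    HomVanishes (derivedSingle M) X j := fun f ↦ by
  obtain ⟨α, ⟨r⟩⟩ := hM
  let F := DerivedCategory.singleFunctor (ModuleCat.{u} Rᵐᵒᵖ) 0
  have h₀ : F.map r.r ≫ f = 0 := homVanishes_left_copies h α _
  have h₁ : F.map r.i ≫ F.map r.r = 𝟙 (F.obj M) := by rw [← F.map_comp, r.retract, F.map_id]
  calc
    f = (F.map r.i ≫ F.map r.r) ≫ f := by rw [h₁]; exact (Category.id_comp _).symm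
    _ = 0 := by rw [Category.assoc, h₀, comp_zero]

/-- Every object `X` receives a morphism from a direct sum of copies of `T` through which all the
morphisms `T ⟶ X` factor. -/
lemma exists_copies_hom (T : ModuleCat.{u} Rᵐᵒᵖ) (X : DerivedCategory (ModuleCat.{u} Rᵐᵒᵖ)) :
    ∃ (α : Type u) (f : derivedSingle (copies T α) ⟶ X),
      ∀ g : derivedSingle T ⟶ X, ∃ l, g = l ≫ f := by
  let K := Q.objPreimage X
  let e : Q.obj K ≅ X := Q.objObjPreimageIso X
  obtain ⟨L, π, hπ, _, _⟩ := exists_quasiIso_projective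
    ((CochainComplex.singleFunctor _ 0).obj T) 0
  have := isKProjective_of_projective L 0
  have hQ : IsIso (Q.map π) := inferInstance
  obtain ⟨e'⟩ : Nonempty (Q.obj L ≅ derivedSingle T) := ⟨@asIso _ _ _ _ (Q.map π) hQ⟩
  obtain ⟨hc⟩ := nonempty_isColimit_singleFunctor_finsupp T (L ⟶ K)
  -- Chain maps out of a projective resolution of `T` index the sum: they form a set in `Type u`,
  -- which the Homs of the derived category need not do, and they represent every morphism.
  refine ⟨L ⟶ K, Cofan.IsColimit.desc hc (fun φ ↦ e'.inv ≫ Q.map φ ≫ e.hom), fun g ↦ ?_⟩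
  obtain ⟨φ, hφ⟩ := exists_Q_map_eq L K (e'.hom ≫ g ≫ e.inv)
  refine ⟨(DerivedCategory.singleFunctor _ 0).map (ModuleCat.ofHom (Finsupp.lsingle φ)), ?_⟩
  refine Eq.trans ?_ (Cofan.IsColimit.fac hc _ φ).symm
  simp [hφ]

/-- The objects `B` of the suspended subcategory generated by `T` such that all morphisms
`T ⟶ B⟦j⟧` vanish for `j > 0`. -/
def suspVanishing (T : ModuleCat.{u} Rᵐᵒᵖ) : ObjectProperty (DerivedCategory (ModuleCat.{u} Rᵐᵒᵖ)) :=
  fun B ↦ Susp.{u} (derivedSingle T) B ∧ ∀ j > 0, HomVanishes (derivedSingle T) B j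

lemma suspVanishing.ext (Z : Triangle (DerivedCategory (ModuleCat.{u} Rᵐᵒᵖ)))
    (hZ : Z ∈ distTriang _) (h₁ : suspVanishing T Z.obj₁) (h₃ : suspVanishing T Z.obj₃) :
    suspVanishing T Z.obj₂ :=
  ⟨(Susp.isSuspendedWithSums _).ext _ hZ h₁.1 h₃.1, fun j hj ↦ .obj₂ hZ (h₁.2 j hj) (h₃.2 j hj)⟩

lemma suspVanishing.of_iso {X Y : DerivedCategory (ModuleCat.{u} Rᵐᵒᵖ)} (e : X ≅ Y)
    (h : suspVanishing T X) : suspVanishing T Y :=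
  ⟨(Susp.isSuspendedWithSums _).of_iso e h.1, fun j hj ↦ (h.2 j hj).of_iso e⟩

end TiltingVanishing

/-! ### The tilting axioms and the aisle generated by T. -/

namespace IsTiltingModule

open CochainComplex DerivedCategory

variable {R : Type u} [Ring R] [HasDerivedCategory.{w} (ModuleCat.{u} Rᵐᵒᵖ)]
  {T : ModuleCat.{u} Rᵐᵒᵖ} {n : ℕ} (hT : IsTiltingModule T n)

include hT

lemma homVanishes_copies (α : Type u) {j : ℤ} (hj : j ≠ 0) :
    HomVanishes (derivedSingle T) (derivedSingle (copies T α)) j := by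
  obtain hj | hj := hj.lt_or_gt
  · exact TStructure.t.homVanishes _ _ 0 0 j (by simpa)
  · obtain ⟨i, rfl⟩ := Int.eq_ofNat_of_zero_le hj.le
    exact (homVanishes_singleFunctor_iff _ _ _).2 (hT.ext_copies i α (by simpa using hj))

lemma homVanishes_of_isLE (X : DerivedCategory (ModuleCat.{u} Rᵐᵒᵖ)) (m j : ℤ) [X.IsLE m]
    (h : m + n < j) : HomVanishes (derivedSingle T) X j := by
  obtain ⟨P, d, ε, hP, hP', hε, h₀, h₁⟩ := hT.resolution
  obtain ⟨Ω, ⟨e⟩, hΩ, hΩ'⟩ := exists_syzygies d ε hε h₀ h₁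
  -- Dimension shifting down from the zero syzygy `Ω (n + 1)`: each projective term costs one
  -- degree.
  suffices ∀ (i k : ℕ), k + i = n + 1 → ∀ j : ℤ, m + k ≤ j → HomVanishes (derivedSingle (Ω i)) X j from
    (this 0 (n + 1) rfl j (by push_cast; lia)).of_iso_left
      ((DerivedCategory.singleFunctor _ 0).mapIso e)
  intro i k hik
  induction k generalizing i with
  | zero =>
    intro j hj
    obtain rfl : i = n + 1 := by lia
    exact .of_isZero_left ((DerivedCategory.singleFunctor _ 0).map_isZero (hΩ _ (hP' _ (by lia))))
  | succ k hk =>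
    intro j hj
    obtain ⟨f, g, w, hS⟩ := hΩ' i
    have := hP i (by lia)
    exact .left_obj₃ hS.singleTriangle_distinguished
      (homVanishes_of_projective (P i) X m j (by push_cast at hj; lia))
      (hk (i + 1) (by lia) (j - 1) (by push_cast at hj; lia))

/-- In the cone of a universal map from a sum of copies of `T`, a map from `T` lifts to `X` because
Ext^1(T, T^(α)) = 0, and then dies. Degree -1 is excluded because there Hom(T, T^(α)) itself
intervenes. -/
lemma exists_kill (X : DerivedCategory (ModuleCat.{u} Rᵐᵒᵖ)) :
    ∃ Y, HasMorphismWithFibre (fun B ↦ ∃ α, B = derivedSingle (copies T α)) X Y ∧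
      HomVanishes (derivedSingle T) Y 0 ∧
      ∀ j, j ≠ -1 → HomVanishes (derivedSingle T) X j → HomVanishes (derivedSingle T) Y j := by
  obtain ⟨α, f, hf⟩ := exists_copies_hom T X
  obtain ⟨Y, g, δ, hT'⟩ := distinguished_cocone_triangle f
  refine ⟨Y, ⟨_, f, g, δ, hT', α, rfl⟩, HomVanishes.zero_iff.2 fun a ↦ ?_, fun j hj h ↦
    .obj₃ hT' h (hT.homVanishes_copies α (by lia))⟩
  obtain ⟨b, hb⟩ := Triangle.coyoneda_exact₃ _ hT' a (hT.homVanishes_copies α one_ne_zero _)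
  obtain ⟨l, rfl⟩ := hf b
  have h₀ : f ≫ g = 0 := comp_distTriang_mor_zero₁₂ _ hT'
  refine hb.trans ((Category.assoc _ _ _).trans ?_)
  exact (congrArg (l ≫ ·) h₀).trans comp_zero

lemma exists_iterated_kill (X : DerivedCategory (ModuleCat.{u} Rᵐᵒᵖ)) (m : ℕ) :
    ∃ Y, HasMorphismWithFibre (suspVanishing T) X Y ∧
      (∀ k : ℤ, -m < k → k ≤ 0 → HomVanishes (derivedSingle T) Y k) ∧
      ∀ j > 0, HomVanishes (derivedSingle T) X j → HomVanishes (derivedSingle T) Y j := by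
  induction m with
  | zero =>
    exact ⟨X, ⟨_, _, _, _, contractible_distinguished₁ X,
      (Susp.isSuspendedWithSums _).of_isZero (isZero_zero _), fun _ _ ↦ .of_isZero (isZero_zero _)⟩,
        by simp; lia, fun _ _ h ↦ h⟩
  | succ m hm =>
    obtain ⟨Y, hXY, hY, hY'⟩ := hm
    -- The next degree to kill is `-m`. This can only disturb degree `-m - 1`, so the degrees
    -- already cleared survive.
    obtain ⟨Z, hYZ, hZ, hZ'⟩ := hT.exists_kill (Y⟦(-m : ℤ)⟧)
    have h₀ := hYZ.shift (P' := suspVanishing T) (m : ℤ) (by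
      rintro _ ⟨α, rfl⟩
      refine ⟨(Susp.isSuspendedWithSums _).shift_of_nonneg
        ((Susp.isSuspendedWithSums _).single_finsupp (Susp.self _) α) _ (by lia), fun j hj ↦ ?_⟩
      exact (HomVanishes.shift_iff rfl).2 (hT.homVanishes_copies α (by lia)))
      ((shiftFunctorCompIsoId _ (-m : ℤ) m (by simp)).app Y)
    have h₁ (j : ℤ) (hj : j ≠ -m - 1) (h : HomVanishes (derivedSingle T) Y j) :
        HomVanishes (derivedSingle T) (Z⟦(m : ℤ)⟧) j :=
      (HomVanishes.shift_iff rfl).2 (hZ' _ (by lia) ((HomVanishes.shift_iff (by lia)).2 h))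
    refine ⟨_, hXY.trans suspVanishing.ext h₀, fun k hk hk' ↦ ?_, fun j hj h ↦
      h₁ j (by lia) (hY' j hj h)⟩
    obtain rfl | hk'' := eq_or_ne k (-m)
    · exact (HomVanishes.shift_iff (by simp)).2 hZ
    · exact h₁ k (by push_cast at hk; lia) (hY k (by push_cast at hk; lia) hk')

/-- The consequences of the coresolution of `R` by summands of copies of `T`. -/
lemma homVanishes_regular {X : DerivedCategory (ModuleCat.{u} Rᵐᵒᵖ)} {j : ℤ}
    (h : ∀ i : ℤ, j ≤ i → i ≤ j + n → HomVanishes (derivedSingle T) X i) :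
    HomVanishes (derivedSingle (ModuleCat.of Rᵐᵒᵖ Rᵐᵒᵖ)) X j := by
  obtain ⟨Q, d, η, hQ, hQ', hη, h₀, h₁⟩ := hT.coresolution
  obtain ⟨Z, ⟨e⟩, hZ, hZ'⟩ := exists_cosyzygies d η hη h₀ h₁
  suffices ∀ (i k : ℕ), i + k = n + 1 → HomVanishes (derivedSingle (Z i)) X (j + i) from
    .of_iso_left (by simpa using this 0 (n + 1) (by simp))
      ((DerivedCategory.singleFunctor _ 0).mapIso (e ≪≫ oppositeRegularIso))
  intro i k hik
  induction k generalizing i with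
  | zero => exact .of_isZero_left ((DerivedCategory.singleFunctor _ 0).map_isZero
      (hZ _ (hQ' _ (by lia))))
  | succ k hk =>
    obtain ⟨f, g, w, hS⟩ := hZ' i
    refine .left_obj₁ hS.singleTriangle_distinguished
      (homVanishes_left_of_isSummandOfCopies (h _ (by lia) (by lia)) (hQ i (by lia))) ?_
    have := hk (i + 1) (by lia)
    rwa [Nat.cast_add, Nat.cast_one, ← add_assoc] at this

lemma susp_regular_shift :
    Susp.{u} (derivedSingle T) ((derivedSingle (ModuleCat.of Rᵐᵒᵖ Rᵐᵒᵖ))⟦(n : ℤ)⟧) := by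
  obtain ⟨Q, d, η, hQ, hQ', hη, h₀, h₁⟩ := hT.coresolution
  obtain ⟨Z, ⟨e⟩, hZ, hZ'⟩ := exists_cosyzygies d η hη h₀ h₁
  have hs : IsSuspendedWithSums.{u} (Susp.{u} (derivedSingle T)) :=
    Susp.isSuspendedWithSums _
  -- The shift is `n - i`: `Z i` is the fibre of a map from `Q i` to `Z (i + 1)`, so one positive
  -- shift is consumed at each step. The integer exponent -1 at `k = 0` is harmless, as `Z (n + 1)`
  -- is zero.
  suffices ∀ (i k : ℕ), i + k = n + 1 → Susp.{u} (derivedSingle T)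
      ((derivedSingle (Z i))⟦(k - 1 : ℤ)⟧) from
    hs.of_iso ((CategoryTheory.shiftFunctor _ (n : ℤ)).mapIso
      ((DerivedCategory.singleFunctor _ 0).mapIso (e ≪≫ oppositeRegularIso)))
      (by simpa using this 0 (n + 1) (by simp))
  intro i k hik
  induction k generalizing i with
  | zero => exact hs.of_isZero ((CategoryTheory.shiftFunctor _ _).map_isZero
      ((DerivedCategory.singleFunctor _ 0).map_isZero (hZ _ (hQ' _ (by lia)))))
  | succ k hk =>
    obtain ⟨f, g, w, hS⟩ := hZ' i
    obtain ⟨α, ⟨r⟩⟩ := hQ i (by lia)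
    have hQi := hs.single_of_retract r (hs.single_finsupp (Susp.self _) α)
    refine hs.ext _ (inv_rot_of_distTriang _ (Triangle.shift_distinguished _
      hS.singleTriangle_distinguished (((k + 1 : ℕ) : ℤ) - 1))) ?_
        (hs.shift_of_nonneg hQi _ (by push_cast; lia))
    refine hs.of_iso ?_ (hk (i + 1) (by lia))
    exact (CategoryTheory.shiftFunctorAdd' _ (((k + 1 : ℕ) : ℤ) - 1) (-1) (k - 1 : ℤ) (by push_cast; lia)).app _

/-- The objects in the aisle `D^{≤ -n}` belong to the suspended subcategory generated by `T`. -/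
lemma susp_of_isLE (X : DerivedCategory (ModuleCat.{u} Rᵐᵒᵖ)) [X.IsLE (-n)] :
    Susp.{u} (derivedSingle T) X := by
  have hs : IsSuspendedWithSums.{u} (Susp.{u} (derivedSingle T)) :=
    Susp.isSuspendedWithSums _
  have := TStructure.t.isLE_shift X (-n) (-n) 0
  exact hs.of_iso ((shiftFunctorCompIsoId _ (-n : ℤ) n (by simp)).app X)
    ((hs.comap_shift n).of_isLE hT.susp_regular_shift (X⟦(-n : ℤ)⟧))

lemma susp_of_homVanishes {X : DerivedCategory (ModuleCat.{u} Rᵐᵒᵖ)}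
    (hX : ∀ j > 0, HomVanishes (derivedSingle T) X j) : Susp.{u} (derivedSingle T) X := by
  obtain ⟨Y, ⟨B, f, g, h, hZ, hB⟩, hY, hY'⟩ := hT.exists_iterated_kill X n
  have : Y.IsLE (-n) := isLE_of_homVanishes fun j hj ↦ hT.homVanishes_regular fun i hi _ ↦ by
    by_cases hi' : i ≤ 0
    · exact hY i (by lia) hi'
    · exact hY' i (by lia) (hX i (by lia))
  exact (Susp.isSuspendedWithSums _).ext _ hZ hB.1 (hT.susp_of_isLE Y)

lemma exists_approximation (X : DerivedCategory (ModuleCat.{u} Rᵐᵒᵖ)) :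
    ∃ Y, HasMorphismWithFibre (suspVanishing T) X Y ∧
      ∀ j ≤ 0, HomVanishes (derivedSingle T) Y j := by
  obtain ⟨X', hX, hX', -⟩ := hT.exists_iterated_kill X (2 * n)
  obtain ⟨F, Y, hF, hY, f, g, h, hZ⟩ := TStructure.t.exists_triangle X' (-n) (-n + 1) rfl
  have : F.IsLE (-n) := ⟨hF⟩
  have : Y.IsGE (-n + 1) := ⟨hY⟩
  have : Projective (ModuleCat.of Rᵐᵒᵖ Rᵐᵒᵖ) := (IsProjective.iff_projective _).1 inferInstance
  -- In degrees up to `-n` the cohomology of `F` is that of `X'`, which vanishes above `-2n` since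
  -- each such degree has a window of length `n` inside the killed range. This sharper bound gives
  -- Hom(T, F[j+1]) = 0 for `j > -n`, so truncating does not bring back Homs from `T`.
  have : F.IsLE (-(2 * n : ℕ)) := isLE_of_homVanishes fun j hj ↦ by
    by_cases hj' : -n < j
    · exact homVanishes_of_projective _ F (-n) j hj'
    · exact .obj₁ hZ ((isGE_iff_homVanishes Y (-n + 1)).1 inferInstance _ (by lia))
        (hT.homVanishes_regular fun i hi hi' ↦ hX' i (by lia) (by lia))
  refine ⟨Y, hX.trans suspVanishing.ext ⟨F, f, g, h, hZ, hT.susp_of_isLE F, fun j hj ↦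
    hT.homVanishes_of_isLE F (-n) j (by lia)⟩, fun j hj ↦ ?_⟩
  by_cases hj' : j ≤ -n
  · exact TStructure.t.homVanishes _ _ 0 (-n + 1) _ (by lia)
  · exact .obj₃ hZ (hX' j (by push_cast; lia) hj)
      (hT.homVanishes_of_isLE F (-(2 * n : ℕ)) (j + 1) (by push_cast; lia))

/-- In the approximation triangle of `X`, both `X` and the shifted fibre are left orthogonal to `Y`,
so the identity of `Y` is zero and `X` is its own approximation. -/
lemma suspVanishing_of_homVanishes {X : DerivedCategory (ModuleCat.{u} Rᵐᵒᵖ)}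
    (hX : ∀ Y, (∀ j ≤ 0, HomVanishes (derivedSingle T) Y j) → HomVanishes X Y 0) :
    suspVanishing T X := by
  obtain ⟨Y, ⟨B, f, g, h, hZ, hB⟩, hY⟩ := hT.exists_approximation X
  have hY' : HomVanishes Y Y 0 := .left_obj₃ hZ (hX Y hY) (hB.1.homVanishes hY _ (by simp))
  have : IsIso f := (Triangle.isZero₃_iff_isIso₁ _ hZ).1
    ((IsZero.iff_id_eq_zero _).2 (HomVanishes.zero_iff.1 hY' _))
  exact hB.of_iso (asIso f)

lemma suspVanishing_eq_susp : suspVanishing T = Susp.{u} (derivedSingle T) := by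
  ext X
  exact ⟨fun h ↦ h.1, fun h ↦ hT.suspVanishing_of_homVanishes fun Y hY ↦
    h.homVanishes hY 0 le_rfl⟩

/-- The suspended subcategory generated by a tilting module is an aisle. -/
theorem exists_isGeneratedBy :
    ∃ t : TStructure (DerivedCategory (ModuleCat.{u} Rᵐᵒᵖ)),
      IsGeneratedBy.{u} t (derivedSingle T) := by
  let V : ObjectProperty (DerivedCategory (ModuleCat.{u} Rᵐᵒᵖ)) :=
    fun X ↦ ∀ j < 0, HomVanishes (derivedSingle T) X j
  have : V.IsClosedUnderIsomorphisms := ⟨fun e h j hj ↦ (h j hj).of_iso e⟩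
  obtain ⟨t, ht⟩ := exists_tStructure_of_hasMorphismWithFibre V
    (fun X hX j hj ↦ (HomVanishes.shift_iff rfl).2 (hX _ (by lia))) (fun X ↦ by
      -- The approximation is orthogonal to `T` in degrees `≤ 0`, while `V` asks only for degrees `<
      -- 0`; shifting by -1 and back makes up the difference.
      obtain ⟨Y, hY, hY'⟩ := hT.exists_approximation (X⟦(-1 : ℤ)⟧)
      refine ⟨_, fun j hj ↦ (HomVanishes.shift_iff rfl).2 (hY' _ (by lia)),
        hY.shift 1 (fun B hB W hW ↦ ?_) ((shiftFunctorCompIsoId _ (-1 : ℤ) 1 (by simp)).app X)⟩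
      rw [← HomVanishes.zero_iff, HomVanishes.shift_left_iff (j := -1) (by simp),
        ← HomVanishes.shift_iff (i := -1) (j := 0) (by simp)]
      exact hB.1.homVanishes (fun j hj ↦ (HomVanishes.shift_iff rfl).2 (hW _ (by lia))) _ le_rfl)
  have hV (Y) : t.IsGE Y 1 ↔ ∀ j ≤ 0, HomVanishes (derivedSingle T) Y j := by
    rw [← t.isGE_shift_iff Y 1 1 0, ← t.ge_iff_isGE, ht]
    exact ⟨fun h j hj ↦ (HomVanishes.shift_iff (by simp)).1 (h (j - 1) (by lia)),
      fun h j hj ↦ (HomVanishes.shift_iff rfl).2 (h _ (by lia))⟩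
  refine ⟨t, ?_⟩
  ext X
  rw [t.le_iff_isLE, t.isLE_iff_orthogonal 0 1 rfl]
  refine ⟨fun h ↦ (hT.suspVanishing_of_homVanishes fun Y hY ↦
    HomVanishes.zero_iff.2 fun f ↦ h Y f ((hV Y).2 hY)).1, fun h Y f hY ↦ ?_⟩
  exact HomVanishes.zero_iff.1 (h.homVanishes ((hV Y).1 hY) 0 le_rfl) f

end IsTiltingModule

/-! ### The co-aisle of a generated t-structure. -/

namespace IsGeneratedBy

variable {C : Type u} [Category.{v} C] [Preadditive C] [HasZeroObject C] [HasShift C ℤ]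
  [∀ n : ℤ, (shiftFunctor C n).Additive] [Pretriangulated C] {𝒯 : TStructure C} {E : C}
  (h : IsGeneratedBy.{t} 𝒯 E)

include h

lemma isLE_zero_iff (X : C) : 𝒯.IsLE X 0 ↔ Susp.{t} E X := by
  rw [← 𝒯.le_iff_isLE, h]

lemma isGE_iff (Y : C) (i : ℤ) : 𝒯.IsGE Y i ↔ ∀ j < i, HomVanishes E Y j := by
  have := (h.isLE_zero_iff E).2 (Susp.self E)
  refine ⟨fun _ j hj ↦ 𝒯.homVanishes _ _ 0 i _ (by simpa), fun hY ↦ ?_⟩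
  rw [𝒯.isGE_iff_orthogonal (i - 1) i (by simp)]
  intro Z f _
  have hZ := (h.isLE_zero_iff _).1 (𝒯.isLE_shift Z (i - 1) (i - 1) 0)
  have := hZ.homVanishes (Y := Y⟦i - 1⟧)
    (fun j hj ↦ (HomVanishes.shift_iff rfl).2 (hY _ (by lia))) 0 le_rfl
  rw [HomVanishes.shift_iff (add_zero _), HomVanishes.shift_left_iff (add_zero _)] at this
  exact HomVanishes.zero_iff.1 this f

end IsGeneratedBy

/-! ### Filterability, type and cogeneration of the pair. -/

namespace IsTiltingModule

open CochainComplex DerivedCategory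

variable {R : Type u} [Ring R] [HasDerivedCategory.{w} (ModuleCat.{u} Rᵐᵒᵖ)]
  {T : ModuleCat.{u} Rᵐᵒᵖ} {n : ℕ} (hT : IsTiltingModule T n)
  {𝒯 : TStructure (DerivedCategory (ModuleCat.{u} Rᵐᵒᵖ))}

/-- Both co-aisles are right orthogonals of shifts, of `R` and of `T` respectively, so their
intersection is the right orthogonal of a set. Replacing `T` by a projective resolution makes this
set K-projective. -/
lemma isRightFilterable (h : IsGeneratedBy.{u} 𝒯 (derivedSingle T)) :
    IsRightFilterable TStructure.t 𝒯 := by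
  intro i
  obtain ⟨L, π, hπ, _, _⟩ := exists_quasiIso_projective
    ((CochainComplex.singleFunctor _ 0).obj T) 0
  have := isKProjective_of_projective L 0
  have hQ : IsIso (Q.map π) := inferInstance
  obtain ⟨e⟩ : Nonempty (Q.obj L ≅ derivedSingle T) := ⟨@asIso _ _ _ _ (Q.map π) hQ⟩
  have : Projective (ModuleCat.of Rᵐᵒᵖ Rᵐᵒᵖ) := (IsProjective.iff_projective _).1 inferInstance
  let N := (CochainComplex.singleFunctor _ 0).obj (ModuleCat.of Rᵐᵒᵖ Rᵐᵒᵖ)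
  let P : ULift.{u} ({j : ℤ // j < i} ⊕ {j : ℤ // j < 0}) → CochainComplex (ModuleCat.{u} Rᵐᵒᵖ) ℤ :=
    fun s ↦ s.down.elim (fun j ↦ N⟦-j.1⟧) (fun j ↦ L⟦-j.1⟧)
  have : ∀ s, (P s).IsKProjective := by
    rintro ⟨⟨j, hj⟩ | ⟨j, hj⟩⟩
    · exact inferInstanceAs (N⟦-j⟧).IsKProjective
    · exact inferInstanceAs (L⟦-j⟧).IsKProjective
  have hom_iff (K : CochainComplex (ModuleCat.{u} Rᵐᵒᵖ) ℤ)
      (Y : DerivedCategory (ModuleCat.{u} Rᵐᵒᵖ)) (j : ℤ) :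
      (∀ f : Q.obj (K⟦-j⟧) ⟶ Y, f = 0) ↔ HomVanishes (Q.obj K) Y j := by
    rw [← HomVanishes.zero_iff]
    have hj := HomVanishes.shift_left_iff (G := Q.obj K) (X := Y) (neg_add_cancel j)
    exact ⟨fun h ↦ hj.1 (h.of_iso_left ((Q.commShiftIso (-j)).app K)),
      fun h ↦ (hj.2 h).of_iso_left ((Q.commShiftIso (-j)).app K).symm⟩
  let V : ObjectProperty (DerivedCategory (ModuleCat.{u} Rᵐᵒᵖ)) :=
    fun Y ↦ ∀ s (f : Q.obj (P s) ⟶ Y), f = 0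
  have hV : V = TStructure.t.ge i ⊓ 𝒯.ge 0 := by
    ext Y
    change V Y ↔ TStructure.t.ge i Y ∧ 𝒯.ge 0 Y
    rw [TStructure.t.ge_iff_isGE, 𝒯.ge_iff_isGE]
    refine Iff.trans ?_ (and_congr (isGE_iff_homVanishes Y i) (h.isGE_iff Y 0)).symm
    constructor
    · exact fun hY ↦ ⟨fun j hj ↦ (hom_iff N Y j).1 (hY ⟨.inl ⟨j, hj⟩⟩),
        fun j hj ↦ ((hom_iff L Y j).1 (hY ⟨.inr ⟨j, hj⟩⟩)).of_iso_left e⟩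
    · rintro ⟨h₁, h₂⟩ ⟨⟨j, hj⟩ | ⟨j, hj⟩⟩
      · exact (hom_iff N Y j).2 (h₁ j hj)
      · exact (hom_iff L Y j).2 ((h₂ j hj).of_iso_left e.symm)
  have : V.IsClosedUnderIsomorphisms := by
    rw [hV]
    infer_instance
  obtain ⟨t, ht⟩ := exists_tStructure_of_hasMorphismWithFibre V (fun X hX ↦ by
    rw [hV] at hX ⊢
    exact ⟨TStructure.t.ge_antitone (show i ≤ i + 1 by simp) _
        (TStructure.t.ge_shift i (-1) (i + 1) (by simp) _ hX.1),
      𝒯.ge_antitone (show (0 : ℤ) ≤ 1 by simp) _ (𝒯.ge_shift 0 (-1) 1 (by simp) _ hX.2)⟩)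
    (fun X ↦ by
      obtain ⟨U, Y, f, g, δ, hZ, hY, hU⟩ := exists_triangle_of_isKProjective P X
      exact ⟨Y, hY, U, f, g, δ, hZ, hU⟩)
  exact ⟨t, ht.trans hV⟩

include hT

lemma heart_of_injective (h : IsGeneratedBy.{u} 𝒯 (derivedSingle T)) (I : ModuleCat.{u} Rᵐᵒᵖ)
    [Injective I] : 𝒯.heart (derivedSingle I) := by
  rw [TStructure.mem_heart_iff, h.isLE_zero_iff, h.isGE_iff]
  refine ⟨hT.susp_of_homVanishes fun j hj ↦ ?_, fun j hj ↦ TStructure.t.homVanishes _ _ 0 0 _ (by simpa)⟩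
  obtain ⟨i, rfl⟩ := Int.eq_ofNat_of_zero_le hj.le
  obtain ⟨k, rfl⟩ := Nat.exists_eq_succ_of_ne_zero (show i ≠ 0 by lia)
  exact (homVanishes_singleFunctor_iff T I (k + 1)).2 (Abelian.Ext.subsingleton_of_injective T I k)

lemma hasTypeGapShift (h : IsGeneratedBy.{u} 𝒯 (derivedSingle T))
    (hpd : projectiveDimension T = n) : HasTypeGapShift TStructure.t 𝒯 n 0 where
  shift := by
    constructor
    · intro X hX
      rw [h] at hX
      rw [TStructure.t.le_iff_isLE, TStructure.t.isLE_iff_orthogonal 0 1 rfl]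
      intro Y f _
      exact HomVanishes.zero_iff.1 (hX.homVanishes
        (fun j hj ↦ TStructure.t.homVanishes _ _ 0 1 _ (by lia)) 0 le_rfl) f
    · intro m hm
      by_contra! hm'
      have := (h.isLE_zero_iff _).2 (Susp.self _)
      -- A shift of at least 1 would put T[-1] in D^{≤0}, hence T in D^{≤-1} ∩ D^{≥0} = 0, whereas
      -- the zero module has projective dimension `⊥`.
      have h₁ := 𝒯.isLE_shift (derivedSingle T) 0 (-1) 1
      have h₂ : TStructure.t.IsLE ((derivedSingle T)⟦(-1 : ℤ)⟧) 0 :=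
        ⟨hm _ (𝒯.le_monotone (show 1 ≤ m by lia) _ h₁.le)⟩
      have h₃ := TStructure.t.isLE_of_shift (derivedSingle T) (-1) (-1) 0
      have h₄ := TStructure.t.isZero (derivedSingle T) (-1) 0
      have h₅ : IsZero T := by
        rw [IsZero.iff_id_eq_zero]
        exact (DerivedCategory.singleFunctor _ 0).map_injective (h₄.eq_of_src _ _)
      rw [projectiveDimension_eq_bot_iff T |>.2 h₅] at hpd
      exact absurd hpd (by simp)
  gap := by
    constructor
    · intro X hX
      have : X.IsLE (-n) := ⟨hX⟩
      rw [h]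
      exact hT.susp_of_isLE X
    · intro m hm
      have : HasProjectiveDimensionLT T (m + 1) := by
        rw [hasProjectiveDimensionLT_iff]
        intro i hi M
        -- The object M[m] lies in D^{≤-m}, hence in Susp(T), so Hom(T, M[m][i-m]) = Ext^i(T, M)
        -- vanishes for `i > m`.
        have h₁ := TStructure.t.isLE_shift (derivedSingle M) 0 m (-m)
        have h₂ := hm _ h₁.le
        rw [h, ← hT.suspVanishing_eq_susp] at h₂
        have := (HomVanishes.shift_iff (k := i) (by simp)).1 (h₂.2 (i - m) (by lia))
        rw [homVanishes_singleFunctor_iff] at this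
        exact fun e ↦ Subsingleton.elim _ _
      have := (projectiveDimension_le_iff T m).2 this
      rw [hpd] at this
      exact_mod_cast this

lemma cogenerates (h : IsGeneratedBy.{u} 𝒯 (derivedSingle T)) :
    Cogenerates (A := (TStructure.t (C := ModuleCat.{u} Rᵐᵒᵖ)).heart.FullSubcategory)
      (fun X ↦ 𝒯.heart X.obj) := by
  intro ⟨X, hX⟩
  have : X.IsLE 0 := ⟨hX.1⟩
  have : X.IsGE 0 := ⟨hX.2⟩
  obtain ⟨M, ⟨e⟩⟩ := X.exists_iso_singleFunctor_obj_of_isGE_of_isLE 0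
  let F := DerivedCategory.singleFunctor (ModuleCat.{u} Rᵐᵒᵖ) 0
  let ι := Injective.ι M
  have hι : (ShortComplex.mk ι (cokernel.π ι) (cokernel.condition ι)).ShortExact :=
    { exact := ShortComplex.exact_cokernel ι }
  refine ⟨⟨derivedSingle (Injective.under M),
      (TStructure.mem_heart_iff _ _).2 ⟨inferInstance, inferInstance⟩⟩, ⟨e.hom ≫ F.map ι⟩,
    hT.heart_of_injective h _, ⟨fun {Z} a b hab ↦ ?_⟩⟩
  have hab' : a.hom ≫ e.hom ≫ F.map ι = b.hom ≫ e.hom ≫ F.map ι :=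
    congrArg (fun f ↦ f.hom) hab
  have := (TStructure.mem_heart_iff _ _).1 Z.property |>.1
  obtain ⟨c, hc⟩ := Triangle.coyoneda_exact₂ _
    (inv_rot_of_distTriang _ hι.singleTriangle_distinguished) ((a.hom - b.hom) ≫ e.hom)
    (show ((a.hom - b.hom) ≫ e.hom) ≫ F.map ι = 0 by
      rw [Category.assoc, Preadditive.sub_comp, hab', sub_self])
  -- The difference of `a` and `b` factors through the cokernel placed in degree 1, which receives
  -- no nonzero map from D^{≤0}.
  have hc₀ : HomVanishes Z.obj ((derivedSingle (cokernel ι))⟦(-1 : ℤ)⟧) 0 :=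
    (HomVanishes.shift_iff (add_zero _)).2 (TStructure.t.homVanishes _ _ 0 0 _ (by simp))
  replace hc₀ : c = 0 := HomVanishes.zero_iff.1 hc₀ c
  rw [hc₀, zero_comp] at hc
  ext
  rw [← sub_eq_zero, ← cancel_mono e.hom, zero_comp]
  exact hc

end IsTiltingModule

theorem theorem2p5 {R : Type u} [Ring R]
    [HasDerivedCategory.{w} (ModuleCat.{u} Rᵐᵒᵖ)]
    (n : ℕ) (T : ModuleCat.{u} Rᵐᵒᵖ)
    (hT : IsTiltingModule T n) (hpd : projectiveDimension T = n) :
    (∃ 𝒯 : TStructure (DerivedCategory (ModuleCat.{u} Rᵐᵒᵖ)),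
      IsGeneratedBy.{u} 𝒯 ((DerivedCategory.singleFunctor _ 0).obj T)) ∧
    ∀ 𝒯 : TStructure (DerivedCategory (ModuleCat.{u} Rᵐᵒᵖ)),
      IsGeneratedBy.{u} 𝒯 ((DerivedCategory.singleFunctor _ 0).obj T) →
        IsRightTiltingPair DerivedCategory.TStructure.t 𝒯 n ∧
        ∀ I : ModuleCat.{u} Rᵐᵒᵖ, Injective I →
          𝒯.heart ((DerivedCategory.singleFunctor _ 0).obj I) :=
  ⟨hT.exists_isGeneratedBy, fun _ h ↦
    ⟨⟨IsTiltingModule.isRightFilterable h, hT.hasTypeGapShift h hpd, hT.cogenerates h⟩,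
      fun I _ ↦ hT.heart_of_injective h I⟩⟩
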